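/- All graphs are finite and simple. A hole is an induced cycle of length $\ge 5$, and an antihole is an induced subgraph that is the complement of a cycle of length $\ge 5$; "odd" refers to the length of the cycle. For integers $s,t,u\ge 1$, the odd stretcher $G_{s,t,u}$ is the graph consisting of three vertex-disjoint paths $i_1\cdots i_{2s}$, $j_1\cdots j_{2t}$, $k_1\cdots k_{2u}$ together with the edges of the two triangles $\{i_1,j_1,k_1\}$ and $\{i_{2s},j_{2t},k_{2u}\}$. A graph $G$ is generalized split if $G$ or its complement $\overline G$ has a partition of its vertex set into disjoint cliques $C_0,C_1,\dots,C_k$ such that there are no edges between $C_i$ and $C_j$ for $1\le i<j\le k$. A graph is perfectly orderable if its vertices have an ordering such that, on every induced ordered subgraph $H$, the greedy coloring uses exactly $\chi(H)$ colors. A graph is obtained by gluing $H_1$ and $H_2$ along a clique if it equals $H_1\cup H_2$ and $H_1\cap H_2$ is a nonempty complete graph. For a graph $G$ on $V$ and a field $K$, let $I_G$ be the kernel of the $K$-algebra homomorphism $K[x_S : S \text{ a stable set of } G]\to K[t_v\ (v\in V),\,s]$, $x_S\mapsto s\prod_{v\in S}t_v$ (the empty set is stable). For a monomial order $<$, the initial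 ideal $\mathrm{in}_<(I_G)$ is generated by the initial monomials of the nonzero elements of $I_G$. The zero ideal counts as generated by quadratic binomials, and as generated by squarefree quadratic monomials. **Proposition 3.5.** Let $G$ be a generalized split graph. (a) If $G$ has no antiholes, then each connected component of $G$ is obtained recursively by gluing along cliques starting from perfectly orderable graphs, and for every field $K$ there is a monomial order $<$ such that $\mathrm{in}_<(I_G)$ is generated by squarefree quadratic monomials. (b) For every field $K$, the ideal $I_G$ is generated by quadratic binomials if and only if $G$ contains no odd holes, no (odd or even) antiholes and no odd stretchers as induced subgraphs. -/

import Mathlib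

open scoped SimpleGraph

universe u v

noncomputable section

namespace StableSetToric

/-! ### Induced subgraphs: holes, antiholes, odd stretchers -/

/-- `G` has no odd holes: no induced cycle of odd length `n ≥ 5`. -/
def NoOddHoles {V : Type u} (G : SimpleGraph V) : Prop :=
  ∀ n : ℕ, 5 ≤ n → Odd n → ¬ (SimpleGraph.cycleGraph n) ⊴ G

/-- `G` has no (odd or even) antiholes: no induced subgraph that is the complement of a cycle of
length `n ≥ 5`. -/
def NoAntiholes {V : Type u} (G : SimpleGraph V) : Prop :=
  ∀ n : ℕ, 5 ≤ n → ¬ (SimpleGraph.cycleGraph n)ᶜ ⊴ G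

/-- The odd stretcher (prism) with parameters `l 0, l 1, l 2`: three disjoint paths, the `i`-th one
on the `2 * l i` vertices `⟨i, 0⟩, …, ⟨i, 2 * l i - 1⟩`, with the three first vertices pairwise
joined and the three last vertices pairwise joined. -/
def oddStretcher (l : Fin 3 → ℕ) : SimpleGraph (Σ i : Fin 3, Fin (2 * l i)) where
  Adj a b :=
    (a.1 = b.1 ∧ ((a.2 : ℕ) + 1 = b.2 ∨ (b.2 : ℕ) + 1 = a.2)) ∨
    (a.1 ≠ b.1 ∧ (((a.2 : ℕ) = 0 ∧ (b.2 : ℕ) = 0) ∨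
      ((a.2 : ℕ) + 1 = 2 * l a.1 ∧ (b.2 : ℕ) + 1 = 2 * l b.1)))
  symm := ⟨by
    rintro a b (⟨h, h'⟩ | ⟨h, h' | h'⟩)
    · exact Or.inl ⟨h.symm, h'.symm⟩
    · exact Or.inr ⟨h.symm, Or.inl h'.symm⟩
    · exact Or.inr ⟨h.symm, Or.inr h'.symm⟩⟩
  loopless := ⟨by
    rintro a (⟨_, h | h⟩ | ⟨h, _⟩)
    · omega
    · omega
    · exact h rfl⟩

/-- `G` has no odd stretchers as induced subgraphs. -/
def NoOddStretchers {V : Type u} (G : SimpleGraph V) : Prop :=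
  ∀ l : Fin 3 → ℕ, (∀ i, 1 ≤ l i) → ¬ (oddStretcher l) ⊴ G

/-! ### Generalized split graphs -/

/-- The vertex set is partitioned into disjoint cliques `C 0, C 1, …, C k` with no edges between
`C i` and `C j` for `1 ≤ i < j ≤ k`. -/
def HasSplitPartition {V : Type u} (G : SimpleGraph V) : Prop :=
  ∃ (k : ℕ) (C : Fin (k + 1) → Set V),
    (∀ i, G.IsClique (C i)) ∧
    (∀ i j, i ≠ j → Disjoint (C i) (C j)) ∧
    (⋃ i, C i) = Set.univ ∧
    ∀ i j, i ≠ 0 → j ≠ 0 → i ≠ j → ∀ v ∈ C i, ∀ w ∈ C j, ¬ G.Adj v w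

/-- `G` is generalized split: `G` or its complement has a partition as above. -/
def IsGeneralizedSplit {V : Type u} (G : SimpleGraph V) : Prop :=
  HasSplitPartition G ∨ HasSplitPartition Gᶜ

/-! ### Perfectly orderable graphs -/

/-- Greedy coloring of a finite graph. The vertices are scanned by increasing rank `r`, and each
vertex gets the least color in `{0, 1, 2, …}` that none of its earlier neighbors has. -/
def greedyColor {V : Type u} (G : SimpleGraph V) (r : V → ℕ) (v : V) : ℕ :=
  sInf {c : ℕ | ∀ w : V, ∀ _h : r w < r v, G.Adj w v → greedyColor G r w ≠ c}
termination_by r v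

/-- The ordering of the vertices of the finite graph `G` by the injective rank function `r` (`v`
precedes `w` when `r v < r w`) is perfect: on each induced ordered subgraph, the number of colors
used by greedy coloring is the chromatic number. -/
def IsPerfectOrdering {V : Type u} (G : SimpleGraph V) (r : V → ℕ) : Prop :=
  ∀ S : Set V,
    ((Set.range (greedyColor (G.induce S) (fun v => r v))).ncard : ℕ∞) =
      (G.induce S).chromaticNumber

/-- A finite graph is perfectly orderable if some ordering of its vertices is perfect. -/
def IsPerfectlyOrderable {V : Type u} (G : SimpleGraph V) : Prop :=
  ∃ r : V → ℕ, Function.Injective r ∧ IsPerfectOrdering G r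

/-! ### Gluing along cliques -/

/-- The subgraph is obtained recursively by gluing along (nonempty) cliques starting from perfectly
orderable graphs: a gluing step forms the union `H₁ ⊔ H₂` of two graphs whose intersection
`H₁ ⊓ H₂` is a complete graph. All graphs that occur in such a recursion are subgraphs of the final
graph, so they are taken in a common ambient graph `G`. -/
inductive IsCliqueGluing {V : Type u} (G : SimpleGraph V) : G.Subgraph → Prop
  | base (H : G.Subgraph) : IsPerfectlyOrderable H.coe → IsCliqueGluing G H
  | glue (H₁ H₂ : G.Subgraph) : IsCliqueGluing G H₁ → IsCliqueGluing G H₂ →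
      (H₁ ⊓ H₂).verts.Nonempty →
      (∀ v ∈ (H₁ ⊓ H₂).verts, ∀ w ∈ (H₁ ⊓ H₂).verts, v ≠ w → (H₁ ⊓ H₂).Adj v w) →
      IsCliqueGluing G (H₁ ⊔ H₂)

/-- A connected component as a (full) subgraph. -/
def componentSubgraph {V : Type u} {G : SimpleGraph V} (c : G.ConnectedComponent) : G.Subgraph :=
  (⊤ : G.Subgraph).induce c.supp

/-! ### The toric ideal of the stable set polytope -/

/-- The stable sets of `G`, including the empty set. -/
abbrev StableSet {V : Type u} (G : SimpleGraph V) : Type u :=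
  {S : Finset V // G.IsIndepSet (S : Set V)}

/-- The homomorphism `π_G : K[x_S : S stable] → K[t_v (v ∈ V), s]` with
`x_S ↦ (∏_{v ∈ S} t_v) * s`. The variable `t_v` is `X (some v)` and `s` is `X none`. -/
def toricMap {V : Type u} (G : SimpleGraph V) (K : Type v) [Field K] :
    MvPolynomial (StableSet G) K →ₐ[K] MvPolynomial (Option V) K :=
  MvPolynomial.aeval fun S =>
    (∏ v ∈ S.1, MvPolynomial.X (some v)) * MvPolynomial.X none

/-- The toric ideal `I_G`, the kernel of `π_G`. -/
def toricIdeal {V : Type u} (G : SimpleGraph V) (K : Type v) [Field K] :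
    Ideal (MvPolynomial (StableSet G) K) :=
  RingHom.ker (toricMap G K)

/-- The ideal is generated by quadratic binomials (the zero ideal is, by the empty set). -/
def GeneratedByQuadraticBinomials {σ : Type u} {K : Type v} [Field K]
    (I : Ideal (MvPolynomial σ K)) : Prop :=
  ∃ B : Set (MvPolynomial σ K),
    (∀ f ∈ B, ∃ a b : σ →₀ ℕ, a ≠ b ∧ a.degree = 2 ∧ b.degree = 2 ∧
      f = MvPolynomial.monomial a 1 - MvPolynomial.monomial b 1) ∧
    I = Ideal.span B

/-- The initial ideal of `I` for the monomial order `m`: generated by the initial monomials of the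
nonzero elements of `I`. -/
def initialIdeal {σ : Type u} {K : Type v} [Field K] (m : MonomialOrder σ)
    (I : Ideal (MvPolynomial σ K)) : Ideal (MvPolynomial σ K) :=
  Ideal.span {g | ∃ f ∈ I, f ≠ 0 ∧ g = MvPolynomial.monomial (m.degree f) 1}

/-- The ideal is generated by squarefree quadratic monomials (the zero ideal is, by the empty
set). -/
def GeneratedBySquarefreeQuadraticMonomials {σ : Type u} {K : Type v} [Field K]
    (I : Ideal (MvPolynomial σ K)) : Prop :=
  ∃ A : Set (σ →₀ ℕ), (∀ a ∈ A, a.degree = 2 ∧ ∀ i, a i ≤ 1) ∧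
    I = Ideal.span ((fun a => MvPolynomial.monomial a (1 : K)) '' A)

end StableSetToric

end

/-! # Generalized split graphs and quadratic generation of stable set ideals

For a generalized split graph, quadratic generation of `I_G` is equivalent to the absence of
antiholes: odd holes never occur, and odd stretchers are excluded with the antihole of length six
(`IsGeneralizedSplit.noOddHoles`, `IsGeneralizedSplit.noOddStretchers`).

*Structure.* Let `C` be the clique such that the rest of `G`, or of its complement, is a disjoint
union of cliques `C i`. If the complement of `G` has this form, ranking `C` last leaves no induced
path `a - b - c - d` with `a` before `b` and `d` before `c`, so this ranking is a perfect ordering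
by Chvátal's theorem. If `G` has this form, `G` is glued along `C` from the graphs `G[C ∪ C i]`. The
nonadjacency matrix between the two cliques `C` and `C i` contains no cycle because `G` has no
antiholes; a doubly lexical ordering of its rows and columns is then `Γ`-free (`exists_gammaFree`),
which says precisely that the corresponding ranking has no obstruction.
`IsGeneralizedSplit.induction_glue` packages both cases.

*Gröbner basis.* A monomial of `K[x_S]` is a multiset of stable sets. A weight on stable sets
singles out the pairs of largest total weight in their quadratic fiber; if every fiber contains at
most one monomial all of whose pairs are maximal (`IsQuadraticWeight`), then the binomials that
replace a pair by a heavier one form a Gröbner basis with squarefree quadratic initial terms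
(`IsGroebnerWeight.exists_initialIdeal`, `IsGroebnerWeight.generatedByQuadraticBinomials`). For an
obstruction-free ranking, such a weight is the square of the binary value of a stable set, and the
monomials with maximal pairs are the greedy colorings. For a gluing along a clique, the weights are
added and perturbed by a convex term that sorts the two sides (`exists_isQuadraticWeight_union`).

*Even antiholes.* The two perfect matchings of a cycle of length `2 * m ≥ 6` are two factorizations
of the same monomial of degree `m`, and no quadratic exchange applies to two edges of such a
matching (`not_isIndContained_of_generatedByQuadraticBinomials`). -/

noncomputable section

namespace StableSetToric

/-! ### Perfect orderings from obstruction-free rankings -/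

section PerfectOrdering

variable {V : Type u} {G : SimpleGraph V} {r : V → ℕ} {W : Set V}

/-- The ranking `r` has no obstruction inside `W`: there is no induced path `a - b - c - d` in
`G[W]` with `r a < r b` and `r d < r c`. -/
def ObstructionFree (G : SimpleGraph V) (r : V → ℕ) (W : Set V) : Prop :=
  ∀ a ∈ W, ∀ b ∈ W, ∀ c ∈ W, ∀ d ∈ W, G.Adj a b → G.Adj b c → G.Adj c d →
    ¬ G.Adj a c → ¬ G.Adj a d → ¬ G.Adj b d → r a < r b → ¬ r d < r c

theorem ObstructionFree.mono {W' : Set V} (h : ObstructionFree G r W) (hW : W' ⊆ W) :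
    ObstructionFree G r W' :=
  fun a ha b hb c hc d hd => h a (hW ha) b (hW hb) c (hW hc) d (hW hd)

/-- Chvátal's lemma: if every vertex of a clique `Q` has an earlier neighbor `p q` and these
neighbors form a stable set, then one of them is adjacent to all of `Q`. -/
theorem ObstructionFree.exists_adj_all (h : ObstructionFree G r Set.univ) (p : V → V)
    (Q : Finset V) : Q.Nonempty → G.IsClique (Q : Set V) →
    (∀ q ∈ Q, G.Adj (p q) q ∧ r (p q) < r q) →
    (∀ q ∈ Q, ∀ q' ∈ Q, ¬ G.Adj (p q) (p q')) →
    ∃ q ∈ Q, ∀ q' ∈ Q, G.Adj (p q) q' := by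
  classical
  induction Q using Finset.strongInduction with
  | H Q ih =>
    intro hne hQ hp hS
    obtain ⟨u, hu, hmax⟩ := Q.exists_max_image r hne
    have aux : ∀ w ∈ Q, (∃ z ∈ Q, z ≠ w) →
        (∃ q ∈ Q, ∀ q' ∈ Q, G.Adj (p q) q') ∨
          ∃ s ∈ Q, s ≠ w ∧ ¬ G.Adj (p s) w ∧ ∀ q' ∈ Q, q' ≠ w → G.Adj (p s) q' := by
      rintro w hw ⟨z, hz, hzw⟩
      obtain ⟨s, hs, hs'⟩ := ih (Q.erase w) (Finset.erase_ssubset hw)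
        ⟨z, Finset.mem_erase.2 ⟨hzw, hz⟩⟩
        (hQ.subset (Finset.coe_subset.2 (Finset.erase_subset _ _)))
        (fun q hq => hp q (Finset.mem_of_mem_erase hq))
        (fun q hq q' hq' => hS q (Finset.mem_of_mem_erase hq) q' (Finset.mem_of_mem_erase hq'))
      have hsQ := Finset.mem_of_mem_erase hs
      by_cases hsw : G.Adj (p s) w
      · refine Or.inl ⟨s, hsQ, fun q' hq' => ?_⟩
        by_cases hq : q' = w
        · exact hq ▸ hsw
        · exact hs' q' (Finset.mem_erase.2 ⟨hq, hq'⟩)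
      · exact Or.inr ⟨s, hsQ, (Finset.mem_erase.1 hs).1, hsw,
          fun q' hq' hne => hs' q' (Finset.mem_erase.2 ⟨hne, hq'⟩)⟩
    by_cases hz : ∃ z ∈ Q, z ≠ u
    · rcases aux u hu hz with h1 | ⟨v, hv, hvu, hvn, hva⟩
      · exact h1
      rcases aux v hv ⟨u, hu, hvu.symm⟩ with h1 | ⟨s, hs, hsv, hsn, hsa⟩
      · exact h1
      -- `p v` misses only `u` and `p s` misses only `v`, so `p v - v - u - p s` is an obstruction.
      exfalso
      refine h (p v) trivial v trivial u trivial (p s) trivial (hp v hv).1 (hQ hv hu hvu)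
        (hsa u hu hvu.symm).symm hvn (hS v hv s hs) (fun h => hsn h.symm) (hp v hv).2 ?_
      exact (hp s hs).2.trans_le (hmax s hs)
    · push Not at hz
      exact ⟨u, hu, fun q' hq' => hz q' hq' ▸ (hp u hu).1⟩

theorem greedyColor_eq (G : SimpleGraph V) (r : V → ℕ) (v : V) :
    greedyColor G r v = sInf {c : ℕ | ∀ w, r w < r v → G.Adj w v → greedyColor G r w ≠ c} := by
  rw [greedyColor]

theorem greedyColor_ne [Finite V] {v w : V} (hr : r w < r v) (hvw : G.Adj w v) :
    greedyColor G r w ≠ greedyColor G r v := by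
  have hne : {c : ℕ | ∀ w, r w < r v → G.Adj w v → greedyColor G r w ≠ c}.Nonempty := by
    obtain ⟨c, hc⟩ := (Set.finite_range (greedyColor G r)).exists_notMem
    exact ⟨c, fun w _ _ hw => hc ⟨w, hw⟩⟩
  have := Nat.sInf_mem hne
  rw [← greedyColor_eq] at this
  exact this w hr hvw

theorem exists_greedyColor_eq {v : V} {c : ℕ} (hc : c < greedyColor G r v) :
    ∃ w, r w < r v ∧ G.Adj w v ∧ greedyColor G r w = c := by
  rw [greedyColor_eq] at hc
  have := Nat.notMem_of_lt_sInf hc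
  simpa using this

/-- For an obstruction-free ranking, a vertex of the largest greedy color extends to a clique with
one vertex of each smaller color; hence greedy coloring is optimal. -/
theorem ObstructionFree.ncard_range_greedyColor [Finite V] (hr : Function.Injective r)
    (h : ObstructionFree G r Set.univ) :
    ((Set.range (greedyColor G r)).ncard : ℕ∞) = G.chromaticNumber := by
  classical
  have hcol : ∀ {v w : V}, G.Adj v w → greedyColor G r v ≠ greedyColor G r w := by
    intro v w hvw
    rcases lt_trichotomy (r v) (r w) with hlt | heq | hgt
    · exact greedyColor_ne hlt hvw
    · exact absurd (hr heq) hvw.ne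
    · exact (greedyColor_ne hgt hvw.symm).symm
  have hfin := Set.finite_range (greedyColor G r)
  apply le_antisymm
  · rcases isEmpty_or_nonempty V with hV | hV
    · simp [Set.range_eq_empty]
    obtain ⟨v, hv⟩ := Finite.exists_max (greedyColor G r)
    set k := greedyColor G r v with hk
    -- A clique realizing the colors `k - m, …, k` is extended downwards one color at a time.
    have key : ∀ m ≤ k, ∃ Q : Finset V, G.IsClique (Q : Set V) ∧ Q.card = m + 1 ∧
        ∀ q ∈ Q, k - m ≤ greedyColor G r q := by
      intro m
      induction m with
      | zero => exact fun _ => ⟨{v}, by simp, by simp, by simp [hk]⟩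
      | succ m ih =>
        intro hm
        obtain ⟨Q, hQ, hcard, hcQ⟩ := ih (by omega)
        have hex : ∀ q, ∃ w, q ∈ Q → r w < r q ∧ G.Adj w q ∧ greedyColor G r w = k - (m + 1) := by
          intro q
          by_cases hq : q ∈ Q
          · obtain ⟨w, hw⟩ := exists_greedyColor_eq (G := G) (r := r) (v := q) (c := k - (m + 1))
              (lt_of_lt_of_le (by omega) (hcQ q hq))
            exact ⟨w, fun _ => hw⟩
          · exact ⟨q, fun hq' => absurd hq' hq⟩
        choose p hp using hex
        obtain ⟨q, hq, hadj⟩ := h.exists_adj_all p Q (Finset.card_pos.1 (by omega)) hQ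
          (fun q hq => ⟨(hp q hq).2.1, (hp q hq).1⟩)
          (fun q hq q' hq' hadj => hcol hadj ((hp q hq).2.2.trans (hp q' hq').2.2.symm))
        have hnot : p q ∉ Q := fun hmem => (hadj _ hmem).ne rfl
        refine ⟨insert (p q) Q, ?_, by rw [Finset.card_insert_of_notMem hnot, hcard], ?_⟩
        · rw [Finset.coe_insert]
          exact hQ.insert fun b hb _ => hadj b hb
        · intro x hx
          rcases Finset.mem_insert.1 hx with rfl | hx
          · exact (hp q hq).2.2.ge
          · exact le_trans (by omega) (hcQ x hx)
    obtain ⟨Q, hQ, hcard, -⟩ := key k le_rfl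
    have hle : (Set.range (greedyColor G r)).ncard ≤ k + 1 := by
      have hsub : Set.range (greedyColor G r) ⊆ Finset.range (k + 1) := by
        rintro _ ⟨w, rfl⟩
        simpa using Nat.lt_succ_of_le (hv w)
      simpa using Set.ncard_le_ncard hsub (Finset.finite_toSet _)
    calc ((Set.range (greedyColor G r)).ncard : ℕ∞) ≤ (Q.card : ℕ∞) := by
          rw [hcard]; exact_mod_cast hle
      _ ≤ G.chromaticNumber := hQ.card_le_chromaticNumber
  · have : Fintype (Set.range (greedyColor G r)) := hfin.fintype
    let C : G.Coloring (Set.range (greedyColor G r)) :=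
      SimpleGraph.Coloring.mk (fun v => ⟨greedyColor G r v, v, rfl⟩)
        (fun hvw heq => hcol hvw (congrArg Subtype.val heq))
    have := C.colorable.chromaticNumber_le
    rwa [← Nat.card_eq_fintype_card, Nat.card_coe_set_eq] at this

theorem ObstructionFree.isPerfectlyOrderable_induce [Finite V] (hr : Function.Injective r)
    (h : ObstructionFree G r W) : IsPerfectlyOrderable (G.induce W) := by
  refine ⟨fun v => r v, hr.comp Subtype.val_injective, fun S => ?_⟩
  refine ObstructionFree.ncard_range_greedyColor
    (hr.comp (Subtype.val_injective.comp Subtype.val_injective)) ?_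
  intro a _ b _ c _ d _
  exact h a a.1.2 b b.1.2 c c.1.2 d d.1.2

end PerfectOrdering

/-! ### Doubly lexical orderings and `Γ`-free matrices -/

theorem sum_two_pow_lt_sum_two_pow {α : Type*} [DecidableEq α] {b : α → ℕ}
    (hb : Function.Injective b) {A B : Finset α} {z : α} (hz : z ∈ A \ B)
    (h : ∀ w ∈ B \ A, b w < b z) : ∑ w ∈ B, 2 ^ b w < ∑ w ∈ A, 2 ^ b w := by
  have h1 : ∑ w ∈ B \ A, 2 ^ b w < 2 ^ b z := by
    have := Nat.geomSum_lt (m := 2) (n := b z) (s := (B \ A).image b) le_rfl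
      (Finset.forall_mem_image.2 h)
    rwa [Finset.sum_image hb.injOn] at this
  have h2 : 2 ^ b z ≤ ∑ w ∈ A \ B, 2 ^ b w :=
    Finset.single_le_sum (f := fun w => 2 ^ b w) (fun _ _ => Nat.zero_le _) hz
  have h3 := Finset.sum_inter_add_sum_sdiff A B (fun w => 2 ^ b w)
  have h4 := Finset.sum_inter_add_sum_sdiff B A (fun w => 2 ^ b w)
  rw [Finset.inter_comm] at h4
  omega

/-- The rows of the 0-1 matrix `M`, ordered by `a`, increase lexicographically when the columns are
ordered by `b` and the last columns are the most significant. The condition is spelled out at the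
last column `y'` in which two rows differ. -/
def LexRows {α β : Type*} (M : α → β → Prop) (a : α → ℕ) (b : β → ℕ) : Prop :=
  ∀ x x' y, a x < a x' → M x y → ¬ M x' y →
    ∃ y', b y < b y' ∧ ¬ M x y' ∧ M x' y' ∧ ∀ z, b y' < b z → (M x z ↔ M x' z)

open Classical in
theorem lexRows_of_forall_perm_le {α β : Type*} [Fintype α] [Fintype β] (M : α → β → Prop)
    {a : α → ℕ} {b : β → ℕ} (hb : Function.Injective b)
    (h : ∀ σ : Equiv.Perm α, ∑ x, 2 ^ a (σ x) * ∑ y with M x y, 2 ^ b y ≤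
      ∑ x, 2 ^ a x * ∑ y with M x y, 2 ^ b y) : LexRows M a b := by
  intro x x' y hx hy hy'
  set R : α → ℕ := fun x => ∑ y with M x y, 2 ^ b y with hR
  have hne : x ≠ x' := fun e => absurd hx (by simp [e])
  -- Exchanging the positions of the two rows cannot increase the sum.
  have hle : R x ≤ R x' := by
    have h1 := h (Equiv.swap x x')
    have h2 : ∑ z, (((2 ^ a (Equiv.swap x x' z) * R z : ℕ) : ℤ) - ((2 ^ a z * R z : ℕ) : ℤ)) =
        ((2 : ℤ) ^ a x' - 2 ^ a x) * (R x - R x') := by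
      rw [Fintype.sum_eq_add x x' hne]
      · simp; ring
      · rintro z ⟨hzx, hzx'⟩
        rw [Equiv.swap_apply_of_ne_of_ne hzx hzx', sub_self]
    rw [Finset.sum_sub_distrib] at h2
    have h3 : ((2 : ℤ) ^ a x' - 2 ^ a x) * (R x - R x') ≤ 0 := by
      rw [← h2]
      have : (∑ z, ((2 ^ a (Equiv.swap x x' z) * R z : ℕ) : ℤ)) ≤
          ∑ z, ((2 ^ a z * R z : ℕ) : ℤ) := by
        exact_mod_cast h1
      linarith
    have h4 : (0 : ℤ) < 2 ^ a x' - 2 ^ a x :=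
      sub_pos.2 (pow_lt_pow_right₀ (by norm_num) hx)
    have h5 := nonpos_of_mul_nonpos_right h3 h4
    have : (R x : ℤ) ≤ R x' := by linarith
    exact_mod_cast this
  obtain ⟨y', hy'D, hmax⟩ := (Finset.univ.filter fun z => ¬ (M x z ↔ M x' z)).exists_max_image b
    ⟨y, by simp [hy, hy']⟩
  have hagree : ∀ z, b y' < b z → (M x z ↔ M x' z) := by
    intro z hz
    by_contra hcon
    exact absurd (hmax z (by simpa using hcon)) (by omega)
  have hcase : ¬ (M x y' ∧ ¬ M x' y') := by
    rintro ⟨h1, h2⟩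
    refine absurd hle (not_le.2 (sum_two_pow_lt_sum_two_pow hb (z := y') (by simp [h1, h2]) ?_))
    intro w hw
    have hw' : M x' w ∧ ¬ M x w := by simpa using hw
    refine lt_of_le_of_ne (hmax w (by simp [hw'])) fun e => ?_
    rw [hb e] at hw'
    exact h2 hw'.1
  have hD : ¬ (M x y' ↔ M x' y') := by simpa using hy'D
  refine ⟨y', lt_of_le_of_ne (hmax y (by simp [hy, hy'])) fun e => ?_, by tauto, by tauto, hagree⟩
  rw [hb e] at hy hy'
  exact hcase ⟨hy, hy'⟩

/-- Every finite 0-1 matrix has a doubly lexical ordering: take orderings `a` of the rows and `b` of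
the columns that maximize `∑ 2 ^ (a x + b y)` over the entries with `M x y`. -/
theorem exists_lexRows {α β : Type*} [Finite α] [Finite β] (M : α → β → Prop) :
    ∃ (a : α → ℕ) (b : β → ℕ), Function.Injective a ∧ Function.Injective b ∧
      LexRows M a b ∧ LexRows (fun y x => M x y) b a := by
  classical
  have := Fintype.ofFinite α
  have := Fintype.ofFinite β
  have : Nonempty (α ≃ Fin (Fintype.card α)) := ⟨Fintype.equivFin α⟩
  have : Nonempty (β ≃ Fin (Fintype.card β)) := ⟨Fintype.equivFin β⟩
  obtain ⟨⟨e, f⟩, hmax⟩ := Finite.exists_max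
    (fun p : (α ≃ Fin (Fintype.card α)) × (β ≃ Fin (Fintype.card β)) =>
      ∑ x, ∑ y, if M x y then 2 ^ (p.1 x : ℕ) * 2 ^ (p.2 y : ℕ) else 0)
  refine ⟨fun x => e x, fun y => f y, Fin.val_injective.comp e.injective,
    Fin.val_injective.comp f.injective, ?_, ?_⟩
  · refine lexRows_of_forall_perm_le M (Fin.val_injective.comp f.injective) fun σ => ?_
    simpa [Finset.mul_sum, Finset.sum_filter, mul_ite] using hmax (σ.trans e, f)
  · refine lexRows_of_forall_perm_le _ (Fin.val_injective.comp e.injective) fun σ => ?_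
    have := hmax (e, σ.trans f)
    simp only at this
    rw [Finset.sum_comm, Finset.sum_comm (γ := α)] at this
    simp only [Finset.sum_filter, Finset.mul_sum, mul_ite, mul_zero]
    simpa only [mul_comm, Equiv.trans_apply] using this

/-- The submatrix on the rows `i 0, …, i n` and columns `j 0, …, j n` has its ones at `(0, 0)` and
next to the diagonal, rows and columns increase, and consecutive rows `i p`, `i (p + 1)` agree
beyond the column `j (p + 2)` (likewise for columns). -/
structure IsZigzag {α β : Type*} (M : α → β → Prop) (a : α → ℕ) (b : β → ℕ) (n : ℕ)
    (i : ℕ → α) (j : ℕ → β) : Prop where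
  row_lt : ∀ p q, p < q → q ≤ n → a (i p) < a (i q)
  col_lt : ∀ p q, p < q → q ≤ n → b (j p) < b (j q)
  iff : ∀ p q, p ≤ n → q ≤ n → (M (i p) (j q) ↔ p + 1 = q ∨ q + 1 = p ∨ (p = 0 ∧ q = 0))
  row_agree : ∀ p, p + 2 ≤ n → ∀ z, b (j (p + 2)) < b z → (M (i p) z ↔ M (i (p + 1)) z)
  col_agree : ∀ p, p + 2 ≤ n → ∀ z, a (i (p + 2)) < a z → (M z (j p) ↔ M z (j (p + 1)))

theorem IsZigzag.not_of_lt {α β : Type*} {M : α → β → Prop} {a : α → ℕ} {b : β → ℕ} {n : ℕ}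
    {i : ℕ → α} {j : ℕ → β} (hZ : IsZigzag M a b n i j) {z : β} (hz : b (j n) < b z)
    (hn : 1 ≤ n) (h0 : ¬ M (i (n - 1)) z) : ∀ p, p + 1 ≤ n → ¬ M (i p) z := by
  have key : ∀ k, ∀ p, p + k + 1 = n → ¬ M (i p) z := by
    intro k
    induction k with
    | zero => intro p hp; have : p = n - 1 := by omega
              exact this ▸ h0
    | succ k ih =>
      intro p hp
      rw [hZ.row_agree p (by omega) z ?_]
      · exact ih (p + 1) (by omega)
      · rcases Nat.lt_or_ge (p + 2) n with h | h
        · exact (hZ.col_lt _ _ h le_rfl).trans hz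
        · have : p + 2 = n := by omega
          exact this ▸ hz
  intro p hp
  exact key (n - 1 - p) p (by omega)

theorem IsZigzag.flip {α β : Type*} {M : α → β → Prop} {a : α → ℕ} {b : β → ℕ} {n : ℕ}
    {i : ℕ → α} {j : ℕ → β} (hZ : IsZigzag M a b n i j) :
    IsZigzag (fun y x => M x y) b a n j i :=
  ⟨hZ.col_lt, hZ.row_lt, fun p q hp hq => (hZ.iff q p hq hp).trans (by omega), hZ.col_agree,
    hZ.row_agree⟩

/-- In a doubly lexically ordered matrix, a zigzag is extended by the last column in which its last
two rows differ and the last row in which its last two columns differ. -/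
theorem IsZigzag.extend {α β : Type*} {M : α → β → Prop} {a : α → ℕ} {b : β → ℕ}
    (hab : LexRows M a b) (hba : LexRows (fun y x => M x y) b a) {n : ℕ} (hn : 1 ≤ n)
    {i : ℕ → α} {j : ℕ → β} (hZ : IsZigzag M a b n i j) :
    ∃ x y, (∀ p ≤ n, a (i p) < a x) ∧ (∀ p ≤ n, b (j p) < b y) ∧
      (∀ p ≤ n, (M (i p) y ↔ p = n)) ∧ (∀ p ≤ n, (M x (j p) ↔ p = n)) ∧
      (∀ z, b y < b z → (M (i (n - 1)) z ↔ M (i n) z)) ∧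
      (∀ z, a x < a z → (M z (j (n - 1)) ↔ M z (j n))) := by
  obtain ⟨y, hy1, hy2, hy3, hy4⟩ := hab (i (n - 1)) (i n) (j n)
    (hZ.row_lt _ _ (by omega) le_rfl) ((hZ.iff _ _ (by omega) le_rfl).2 (by omega))
    (fun h => by have := (hZ.iff _ _ le_rfl le_rfl).1 h; omega)
  obtain ⟨x, hx1, hx2, hx3, hx4⟩ := hba (j (n - 1)) (j n) (i n)
    (hZ.col_lt _ _ (by omega) le_rfl) ((hZ.iff _ _ le_rfl (by omega)).2 (by omega))
    (fun h => by have := (hZ.iff _ _ le_rfl le_rfl).1 h; omega)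
  refine ⟨x, y, ?_, ?_, ?_, ?_, hy4, hx4⟩
  · intro p hp
    rcases hp.lt_or_eq with h | rfl
    · exact (hZ.row_lt _ _ h le_rfl).trans hx1
    · exact hx1
  · intro p hp
    rcases hp.lt_or_eq with h | rfl
    · exact (hZ.col_lt _ _ h le_rfl).trans hy1
    · exact hy1
  · intro p hp
    rcases hp.lt_or_eq with h | rfl
    · exact iff_of_false (hZ.not_of_lt hy1 hn hy2 p h) h.ne
    · exact iff_of_true hy3 rfl
  · intro p hp
    rcases hp.lt_or_eq with h | rfl
    · exact iff_of_false (hZ.flip.not_of_lt hx1 hn hx2 p h) h.ne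
    · exact iff_of_true hx3 rfl

/-- A finite 0-1 matrix without a cycle submatrix of size `n ≥ 3` has orderings of its rows and
columns for which no submatrix on rows `x < x'` and columns `y < y'` is `Γ`-shaped, that is, has
its only zero at `(x', y')`. -/
theorem exists_gammaFree {α β : Type*} [Finite α] [Finite β] (M : α → β → Prop)
    (hM : ∀ (n : ℕ) (i : ℕ → α) (j : ℕ → β), 3 ≤ n → Set.InjOn i (Set.Iio n) →
      Set.InjOn j (Set.Iio n) →
      ¬ ∀ p q, p < n → q < n → (M (i p) (j q) ↔
        p + 1 = q ∨ q + 1 = p ∨ (p = 0 ∧ q = 0) ∨ (p + 1 = n ∧ q + 1 = n))) :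
    ∃ (a : α → ℕ) (b : β → ℕ), Function.Injective a ∧ Function.Injective b ∧
      ∀ x x' y y', a x < a x' → b y < b y' → M x y → M x y' → M x' y → M x' y' := by
  obtain ⟨a, b, ha, hb, hab, hba⟩ := exists_lexRows M
  refine ⟨a, b, ha, hb, fun x x' y y' hx hy h1 h2 h3 => ?_⟩
  by_contra h4
  -- A `Γ` would give zigzags of every size, which a finite matrix cannot contain.
  have key : ∀ n, ∃ i j, IsZigzag M a b (n + 1) i j := by
    intro n
    induction n with
    | zero =>
      refine ⟨fun p => if p = 0 then x else x', fun p => if p = 0 then y else y',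
        ?_, ?_, ?_, ?_, ?_⟩
      · intro p q hpq hq
        obtain ⟨rfl, rfl⟩ : p = 0 ∧ q = 1 := by omega
        simpa using hx
      · intro p q hpq hq
        obtain ⟨rfl, rfl⟩ : p = 0 ∧ q = 1 := by omega
        simpa using hy
      · intro p q hp hq
        obtain rfl | rfl : p = 0 ∨ p = 1 := by omega
        all_goals obtain rfl | rfl : q = 0 ∨ q = 1 := by omega
        all_goals simp [h1, h2, h3, h4]
      · intro p hp; omega
      · intro p hp; omega
    | succ n ih =>
      obtain ⟨i, j, hZ⟩ := ih
      obtain ⟨x, y, hx1, hy1, hx2, hy2, hx3, hy3⟩ := hZ.extend hab hba (by omega)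
      have hi : ∀ p ≤ n + 1, Function.update i (n + 2) x p = i p := fun p hp =>
        Function.update_of_ne (by omega) _ _
      have hj : ∀ p ≤ n + 1, Function.update j (n + 2) y p = j p := fun p hp =>
        Function.update_of_ne (by omega) _ _
      have hi' : Function.update i (n + 2) x (n + 2) = x := Function.update_self _ _ _
      have hj' : Function.update j (n + 2) y (n + 2) = y := Function.update_self _ _ _
      have hrow : ∀ p q, p < q → q ≤ n + 2 →
          a (Function.update i (n + 2) x p) < a (Function.update i (n + 2) x q) := by
        intro p q hpq hq
        rcases hq.lt_or_eq with h | rfl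
        · rw [hi p (by omega), hi q (by omega)]; exact hZ.row_lt p q hpq (by omega)
        · rw [hi p (by omega), hi']; exact hx1 p (by omega)
      have hcol : ∀ p q, p < q → q ≤ n + 2 →
          b (Function.update j (n + 2) y p) < b (Function.update j (n + 2) y q) := by
        intro p q hpq hq
        rcases hq.lt_or_eq with h | rfl
        · rw [hj p (by omega), hj q (by omega)]; exact hZ.col_lt p q hpq (by omega)
        · rw [hj p (by omega), hj']; exact hy1 p (by omega)
      have hiff : ∀ p q, p ≤ n + 2 → q ≤ n + 2 → ¬ (p = n + 2 ∧ q = n + 2) →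
          (M (Function.update i (n + 2) x p) (Function.update j (n + 2) y q) ↔
            p + 1 = q ∨ q + 1 = p ∨ (p = 0 ∧ q = 0)) := by
        intro p q hp hq hpq
        rcases hp.lt_or_eq with h | rfl
        · rw [hi p (by omega)]
          rcases hq.lt_or_eq with h' | rfl
          · rw [hj q (by omega)]; exact hZ.iff p q (by omega) (by omega)
          · rw [hj', hx2 p (by omega)]; omega
        · rcases hq.lt_or_eq with h' | rfl
          · rw [hi', hj q (by omega), hy2 q (by omega)]; omega
          · exact absurd ⟨rfl, rfl⟩ hpq
      by_cases hxy : M x y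
      · -- A one in the new corner closes the zigzag to a cycle.
        refine absurd ?_ (hM (n + 3) (Function.update i (n + 2) x) (Function.update j (n + 2) y)
          (by omega) ?_ ?_)
        · intro p q hp hq
          by_cases hpq : p = n + 2 ∧ q = n + 2
          · obtain ⟨rfl, rfl⟩ := hpq
            rw [hi', hj']
            simpa using hxy
          · rw [hiff p q (by omega) (by omega) hpq]; omega
        · intro p hp q hq e
          have hp : p < n + 3 := hp
          have hq : q < n + 3 := hq
          rcases lt_trichotomy p q with h | h | h
          · exact absurd (congrArg a e) (hrow p q h (by omega)).ne
          · exact h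
          · exact absurd (congrArg a e) (hrow q p h (by omega)).ne'
        · intro p hp q hq e
          have hp : p < n + 3 := hp
          have hq : q < n + 3 := hq
          rcases lt_trichotomy p q with h | h | h
          · exact absurd (congrArg b e) (hcol p q h (by omega)).ne
          · exact h
          · exact absurd (congrArg b e) (hcol q p h (by omega)).ne'
      · refine ⟨Function.update i (n + 2) x, Function.update j (n + 2) y, hrow, hcol, ?_, ?_, ?_⟩
        · intro p q hp hq
          by_cases hpq : p = n + 2 ∧ q = n + 2
          · obtain ⟨rfl, rfl⟩ := hpq
            rw [hi', hj']
            exact iff_of_false hxy (by omega)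
          · exact hiff p q hp hq hpq
        · intro p hp
          rcases (show p ≤ n by omega).lt_or_eq with h | rfl
          · rw [hi p (by omega), hi (p + 1) (by omega), hj (p + 2) (by omega)]
            exact hZ.row_agree p (by omega)
          · rw [hi p (by omega), hi (p + 1) (by omega), hj']
            exact hx3
        · intro p hp
          rcases (show p ≤ n by omega).lt_or_eq with h | rfl
          · rw [hj p (by omega), hj (p + 1) (by omega), hi (p + 2) (by omega)]
            exact hZ.col_agree p (by omega)
          · rw [hj p (by omega), hj (p + 1) (by omega), hi']
            exact hy3
  obtain ⟨i, j, hZ⟩ := key (Nat.card α)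
  have hinj : Function.Injective fun p : Fin (Nat.card α + 1) => i p := by
    intro p q e
    have e' := congrArg a e
    have hp := p.2
    have hq := q.2
    rcases lt_trichotomy (p : ℕ) q with h | h | h
    · exact absurd e' (hZ.row_lt p q h (by omega)).ne
    · exact Fin.ext h
    · exact absurd e' (hZ.row_lt q p h (by omega)).ne'
  have := Nat.card_le_card_of_injective _ hinj
  simp at this

/-! ### Obstruction-free rankings of generalized split graphs -/

section Rankings

variable {V : Type u} {G : SimpleGraph V}

theorem cycleGraph_adj_iff_val {n : ℕ} (hn : 3 ≤ n) (p q : Fin n) :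
    (SimpleGraph.cycleGraph n).Adj p q ↔ (p : ℕ) + 1 = q ∨ (q : ℕ) + 1 = p ∨
      ((p : ℕ) = 0 ∧ (q : ℕ) + 1 = n) ∨ ((q : ℕ) = 0 ∧ (p : ℕ) + 1 = n) := by
  rw [SimpleGraph.cycleGraph_adj', Fin.sub_def, Fin.sub_def]
  have aux : ∀ a b : ℕ, a < n → b < n →
      ((n - b + a) % n = 1 ↔ b + 1 = a ∨ (a = 0 ∧ b + 1 = n)) := by
    intro a b ha hb
    rcases Nat.lt_or_ge (n - b + a) n with h | h
    · rw [Nat.mod_eq_of_lt h]; omega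
    · rw [Nat.mod_eq_sub_mod h, Nat.mod_eq_of_lt (by omega)]; omega
  have h1 := aux p q p.2 q.2
  have h2 := aux q p q.2 p.2
  simp only [h1, h2]
  omega

/-- A cycle in the nonadjacency matrix between two disjoint cliques is an antihole: going around
the cycle, the even positions lie in one clique and the odd ones in the other, and position `k` has
index `min k (2 * n - 1 - k)`. -/
theorem isIndContained_compl_cycleGraph {X Y : Set V} (hX : G.IsClique X) (hY : G.IsClique Y)
    (hXY : Disjoint X Y) {n : ℕ} (hn : 3 ≤ n) {i j : ℕ → V} (hiX : ∀ p < n, i p ∈ X)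
    (hjY : ∀ p < n, j p ∈ Y) (hi : Set.InjOn i (Set.Iio n)) (hj : Set.InjOn j (Set.Iio n))
    (h : ∀ p q, p < n → q < n → (¬ G.Adj (i p) (j q) ↔
      p + 1 = q ∨ q + 1 = p ∨ (p = 0 ∧ q = 0) ∨ (p + 1 = n ∧ q + 1 = n))) :
    (SimpleGraph.cycleGraph (2 * n))ᶜ ⊴ G := by
  let t : ℕ → ℕ := fun k => min k (2 * n - 1 - k)
  have ht : ∀ k < 2 * n, t k < n := fun k hk => by simp only [t]; omega
  let f : Fin (2 * n) → V := fun k => if (k : ℕ) % 2 = 0 then i (t k) else j (t k)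
  have hne : ∀ p q, p < n → q < n → i p ≠ j q := fun p q hp hq e =>
    Set.disjoint_left.1 hXY (hiX p hp) (e ▸ hjY q hq)
  have hinj : Function.Injective f := by
    intro k l e
    have hk := k.2
    have hl := l.2
    simp only [f] at e
    split_ifs at e with h1 h2 h2
    · have := hi (ht k hk) (ht l hl) e
      simp only [t] at this
      exact Fin.ext (by omega)
    · exact absurd e (hne _ _ (ht k hk) (ht l hl))
    · exact absurd e.symm (hne _ _ (ht l hl) (ht k hk))
    · have := hj (ht k hk) (ht l hl) e
      simp only [t] at this
      exact Fin.ext (by omega)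
  refine ⟨⟨⟨f, hinj⟩, ?_⟩⟩
  intro k l
  simp only [Function.Embedding.coeFn_mk, SimpleGraph.compl_adj,
    cycleGraph_adj_iff_val (show 3 ≤ 2 * n by omega)]
  rcases eq_or_ne k l with rfl | hkl
  · simp
  have hkl' : (k : ℕ) ≠ l := fun e => hkl (Fin.ext e)
  have hk := k.2
  have hl := l.2
  have hfne : f k ≠ f l := fun e => hkl (hinj e)
  simp only [ne_eq, hkl, not_false_eq_true, true_and]
  simp only [f] at hfne ⊢
  split_ifs at hfne ⊢ with h1 h2 h2
  · exact iff_of_true (hX (hiX _ (ht k hk)) (hiX _ (ht l hl)) hfne) (by omega)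
  · rw [← not_iff_not, h _ _ (ht k hk) (ht l hl)]
    simp only [t]
    omega
  · rw [SimpleGraph.adj_comm, ← not_iff_not, h _ _ (ht l hl) (ht k hk)]
    simp only [t]
    omega
  · exact iff_of_true (hY (hjY _ (ht k hk)) (hjY _ (ht l hl)) hfne) (by omega)

/-- Two disjoint cliques without antiholes between them: a `Γ`-free ordering of the nonadjacency
matrix gives an obstruction-free ranking, because an induced path on four vertices has one edge in
each clique. -/
theorem exists_obstructionFree_union [Finite V] {X Y : Set V} (hX : G.IsClique X)
    (hY : G.IsClique Y) (hXY : Disjoint X Y) (hG : NoAntiholes G) :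
    ∃ r : V → ℕ, Function.Injective r ∧ ObstructionFree G r (X ∪ Y) := by
  classical
  obtain ⟨a, b, ha, hb, hab⟩ := exists_gammaFree
    (fun x y : V => x ∈ X ∧ y ∈ Y ∧ ¬ G.Adj x y) (by
      intro n i j hn hi hj h
      have hiX : ∀ p < n, i p ∈ X := fun p hp => by
        by_cases h0 : p = 0
        · subst h0; exact ((h 0 0 hp hp).2 (by omega)).1
        · exact ((h p (p - 1) hp (by omega)).2 (by omega)).1
      have hjY : ∀ p < n, j p ∈ Y := fun p hp => by
        by_cases h0 : p = 0
        · subst h0; exact ((h 0 0 hp hp).2 (by omega)).2.1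
        · exact ((h (p - 1) p (by omega) hp).2 (by omega)).2.1
      refine hG (2 * n) (by omega) (isIndContained_compl_cycleGraph hX hY hXY hn hiX hjY hi hj ?_)
      intro p q hp hq
      rw [← h p q hp hq]
      simp [hiX p hp, hjY q hq])
  refine ⟨fun v => if v ∈ X then 2 * a v else 2 * b v + 1, ?_, ?_⟩
  · intro v w e
    simp only at e
    split_ifs at e
    · exact ha (by omega)
    · omega
    · omega
    · exact hb (by omega)
  · have hnX : ∀ {v}, v ∈ Y → v ∉ X := fun hv hv' => Set.disjoint_left.1 hXY hv' hv
    intro p hp q hq s hs t ht hpq hqs hst hnps hnpt hnqt h1 h2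
    have hps : p ≠ s := by rintro rfl; exact hnpt hst
    have hpt : p ≠ t := by rintro rfl; exact hnqt hpq.symm
    have hqt : q ≠ t := by rintro rfl; exact hnpt hpq
    have hXX : ∀ {v w}, v ≠ w → ¬ G.Adj v w → v ∈ X → w ∈ X → False :=
      fun hne hn hv hw => hn (hX hv hw hne)
    have hYY : ∀ {v w}, v ≠ w → ¬ G.Adj v w → v ∈ Y → w ∈ Y → False :=
      fun hne hn hv hw => hn (hY hv hw hne)
    rcases hp with hp | hp
    · have hs' : s ∈ Y := hs.resolve_left fun h => hXX hps hnps hp h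
      have ht' : t ∈ Y := ht.resolve_left fun h => hXX hpt hnpt hp h
      have hq' : q ∈ X := hq.resolve_right fun h => hYY hqt hnqt h ht'
      simp only [hp, hq', hnX hs', hnX ht', if_true, if_false] at h1 h2
      exact (hab p q t s (by omega) (by omega) ⟨hp, ht', hnpt⟩ ⟨hp, hs', hnps⟩
        ⟨hq', ht', hnqt⟩).2.2 hqs
    · have hs' : s ∈ X := hs.resolve_right fun h => hYY hps hnps hp h
      have ht' : t ∈ X := ht.resolve_right fun h => hYY hpt hnpt hp h
      have hq' : q ∈ Y := hq.resolve_left fun h => hXX hqt hnqt h ht'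
      simp only [ht', hs', hnX hp, hnX hq', if_true, if_false] at h1 h2
      exact (hab t s p q (by omega) (by omega) ⟨ht', hp, fun h => hnpt h.symm⟩
        ⟨ht', hq', fun h => hnqt h.symm⟩ ⟨hs', hp, fun h => hnps h.symm⟩).2.2 hqs.symm

/-- `C` is a clique and `G - C` has no induced path on three vertices, that is, it is a disjoint
union of cliques. -/
structure IsUnipolarCore (G : SimpleGraph V) (C : Set V) : Prop where
  isClique : G.IsClique C
  adj_of_adj : ∀ a b c, a ∉ C → b ∉ C → c ∉ C → G.Adj a b → G.Adj b c → a ≠ c → G.Adj a c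

theorem HasSplitPartition.exists_isUnipolarCore (h : HasSplitPartition G) :
    ∃ C : Set V, IsUnipolarCore G C := by
  obtain ⟨k, C, hC, hdisj, hcov, hno⟩ := h
  refine ⟨C 0, hC 0, fun a b c ha hb hc hab hbc hac => ?_⟩
  have hmem : ∀ v, v ∉ C 0 → ∃ i, i ≠ 0 ∧ v ∈ C i := by
    intro v hv
    obtain ⟨i, hi⟩ := Set.mem_iUnion.1 (hcov ▸ Set.mem_univ v)
    exact ⟨i, fun e => hv (e ▸ hi), hi⟩
  obtain ⟨i, hi, hai⟩ := hmem a ha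
  obtain ⟨j, hj, hbj⟩ := hmem b hb
  obtain ⟨l, hl, hcl⟩ := hmem c hc
  have hij : i = j := by
    by_contra hne
    exact hno i j hi hj hne a hai b hbj hab
  have hjl : j = l := by
    by_contra hne
    exact hno j l hj hl hne b hbj c hcl hbc
  subst hij hjl
  exact hC i hai hcl hac

/-- If the complement is unipolar, ranking the core last leaves no obstruction: of the two middle
vertices of an induced path on four vertices at most one lies in the core, so one end does. -/
theorem IsUnipolarCore.exists_obstructionFree_of_compl [Finite V] {C : Set V}
    (h : IsUnipolarCore Gᶜ C) :
    ∃ r : V → ℕ, Function.Injective r ∧ ObstructionFree G r Set.univ := by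
  classical
  obtain ⟨n, ⟨e⟩⟩ := Finite.exists_equiv_fin V
  have hlt : ∀ v, (e v : ℕ) < n := fun v => (e v).2
  refine ⟨fun v => if v ∈ C then n + e v else e v, ?_, ?_⟩
  · intro v w hvw
    have := hlt v
    have := hlt w
    simp only at hvw
    apply e.injective
    apply Fin.ext
    split_ifs at hvw <;> omega
  · intro a _ b _ c _ d _ hab hbc hcd hac had hbd h1 h2
    have hne1 : a ≠ c := by rintro rfl; exact had hcd
    have hne2 : a ≠ d := by rintro rfl; exact hbd hab.symm
    have hne3 : b ≠ d := by rintro rfl; exact had hab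
    have hC : ∀ {v w}, G.Adj v w → v ∈ C → w ∉ C := fun hvw hv hw =>
      ((SimpleGraph.compl_adj _ _ _).1 (h.isClique hv hw hvw.ne)).2 hvw
    have haC : a ∉ C := fun ha => by
      have := hlt b
      simp only [ha, hC hab ha, if_true, if_false] at h1
      omega
    have hdC : d ∉ C := fun hd => by
      have := hlt c
      simp only [hd, hC hcd.symm hd, if_true, if_false] at h2
      omega
    have key : ∀ x y z, x ∉ C → y ∉ C → z ∉ C → x ≠ y → y ≠ z → ¬ G.Adj x y → ¬ G.Adj y z →
        ¬ G.Adj x z := fun x y z hx hy hz hxy hyz hn1 hn2 hadj =>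
      ((SimpleGraph.compl_adj _ _ _).1 (h.adj_of_adj x y z hx hy hz
        ((SimpleGraph.compl_adj _ _ _).2 ⟨hxy, hn1⟩)
        ((SimpleGraph.compl_adj _ _ _).2 ⟨hyz, hn2⟩) hadj.ne)).2 hadj
    have hbC : b ∈ C := by
      by_contra hb
      exact key a d b haC hdC hb hne2 hne3.symm had (fun h => hbd h.symm) hab
    have hcC : c ∈ C := by
      by_contra hc
      exact key c a d hc haC hdC hne1.symm hne2 (fun h => hac h.symm) had hcd
    exact hC hbc hbC hcC

end Rankings

/-! ### Gluing along the core of a unipolar graph -/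

section CliqueGluing

variable {V : Type u} {G : SimpleGraph V}

/-- Induction over the vertex subsets of a unipolar graph without antiholes: off the core, the graph
is a disjoint union of cliques, and the unions of the core with these cliques are glued along the
core. -/
theorem IsUnipolarCore.induction_glue [Finite V] {C : Set V} (h : IsUnipolarCore G C)
    (hG : NoAntiholes G) {P : Set V → Prop}
    (base : ∀ W, (∃ r : V → ℕ, Function.Injective r ∧ ObstructionFree G r W) → P W)
    (glue : ∀ W₁ W₂, (W₁ ∩ W₂).Nonempty → G.IsClique (W₁ ∩ W₂) →
      (∀ v ∈ W₁ \ W₂, ∀ w ∈ W₂ \ W₁, ¬ G.Adj v w) → P W₁ → P W₂ → P (W₁ ∪ W₂)) (W : Set V) :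
    P W := by
  rcases (W ∩ C).eq_empty_or_nonempty with hD | hD
  · obtain ⟨n, ⟨e⟩⟩ := Finite.exists_equiv_fin V
    refine base W ⟨fun v => e v, Fin.val_injective.comp e.injective, ?_⟩
    intro a ha b hb c hc d hd hab hbc hcd hac had
    have hn : ∀ v ∈ W, v ∉ C := fun v hv hv' => Set.notMem_empty v (hD ▸ ⟨hv, hv'⟩)
    have hne : a ≠ c := by rintro rfl; exact had hcd
    exact absurd (h.adj_of_adj a b c (hn a ha) (hn b hb) (hn c hc) hab hbc hne) hac
  · induction hk : W.ncard using Nat.strong_induction_on generalizing W with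
    | _ k ih =>
      rcases (W \ C).eq_empty_or_nonempty with hE | ⟨v, hvW, hvC⟩
      · obtain ⟨r, hr, ho⟩ := exists_obstructionFree_union h.isClique
          (Y := ∅) (by simp) (by simp) hG
        exact base W ⟨r, hr, ho.mono (by simpa using Set.sdiff_eq_empty.1 hE)⟩
      set K : Set V := {w | w ∈ W ∧ w ∉ C ∧ (w = v ∨ G.Adj v w)} with hK
      have hKclique : G.IsClique K := by
        rintro x ⟨-, hxC, rfl | hx⟩ y ⟨-, hyC, rfl | hy⟩ hxy
        · exact absurd rfl hxy
        · exact hy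
        · exact hx.symm
        · exact h.adj_of_adj x v y hxC hvC hyC hx.symm hy hxy
      obtain ⟨r, hr, ho⟩ := exists_obstructionFree_union h.isClique hKclique
        (Set.disjoint_left.2 fun x hx hx' => hx'.2.1 hx) hG
      have hW1 : P ((W ∩ C) ∪ K) :=
        base _ ⟨r, hr, ho.mono (Set.union_subset_union_left _ Set.inter_subset_right)⟩
      have hvK : v ∈ K := ⟨hvW, hvC, Or.inl rfl⟩
      have hD' : ((W \ K) ∩ C).Nonempty := by
        obtain ⟨x, hx, hx'⟩ := hD
        exact ⟨x, ⟨hx, fun hxK => hxK.2.1 hx'⟩, hx'⟩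
      have hlt : (W \ K).ncard < k := by
        rw [← hk]
        exact Set.ncard_lt_ncard ⟨Set.sdiff_subset, fun hs => (hs hvW).2 hvK⟩ (Set.toFinite W)
      have hW2 : P (W \ K) := ih _ hlt _ hD' rfl
      have hinter : ((W ∩ C) ∪ K) ∩ (W \ K) = W ∩ C := by
        ext x
        constructor
        · rintro ⟨hx | hx, hx'⟩
          · exact hx
          · exact absurd hx hx'.2
        · exact fun hx => ⟨Or.inl hx, hx.1, fun hxK => hxK.2.1 hx.2⟩
      have hunion : ((W ∩ C) ∪ K) ∪ (W \ K) = W := by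
        ext x
        constructor
        · rintro ((hx | hx) | hx)
          exacts [hx.1, hx.1, hx.1]
        · intro hx
          by_cases hxK : x ∈ K
          · exact Or.inl (Or.inr hxK)
          · exact Or.inr ⟨hx, hxK⟩
      rw [← hunion]
      have hWC : G.IsClique (W ∩ C) := h.isClique.subset Set.inter_subset_right
      refine glue _ _ (by rwa [hinter]) (by rwa [hinter]) ?_ hW1 hW2
      rintro x ⟨hx, hx'⟩ y ⟨⟨hyW, hyK⟩, hy'⟩ hxy
      have hxK : x ∈ K := by
        rcases hx with hx | hx
        · exact absurd ⟨hx.1, fun hxK => hxK.2.1 hx.2⟩ hx'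
        · exact hx
      have hyC : y ∉ C := fun hyC => hy' (Or.inl ⟨hyW, hyC⟩)
      refine hyK ⟨hyW, hyC, ?_⟩
      obtain ⟨-, hxC, rfl | hx⟩ := hxK
      · exact Or.inr hxy
      · by_cases e : y = v
        · exact Or.inl e
        · exact Or.inr (h.adj_of_adj v x y hvC hxC hyC hx hxy (Ne.symm e))

theorem IsCliqueGluing.of_obstructionFree [Finite V] {W : Set V} {r : V → ℕ}
    (hr : Function.Injective r) (h : ObstructionFree G r W) :
    IsCliqueGluing G ((⊤ : G.Subgraph).induce W) := by
  refine IsCliqueGluing.base _ ?_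
  rw [← SimpleGraph.induce_eq_coe_induce_top]
  exact h.isPerfectlyOrderable_induce hr

theorem IsCliqueGluing.union {W₁ W₂ : Set V} (hne : (W₁ ∩ W₂).Nonempty)
    (hcl : G.IsClique (W₁ ∩ W₂)) (hno : ∀ v ∈ W₁ \ W₂, ∀ w ∈ W₂ \ W₁, ¬ G.Adj v w)
    (h₁ : IsCliqueGluing G ((⊤ : G.Subgraph).induce W₁))
    (h₂ : IsCliqueGluing G ((⊤ : G.Subgraph).induce W₂)) :
    IsCliqueGluing G ((⊤ : G.Subgraph).induce (W₁ ∪ W₂)) := by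
  have heq : (⊤ : G.Subgraph).induce (W₁ ∪ W₂) =
      (⊤ : G.Subgraph).induce W₁ ⊔ (⊤ : G.Subgraph).induce W₂ := by
    ext v w
    · simp
    · simp only [SimpleGraph.Subgraph.induce_adj, SimpleGraph.Subgraph.top_adj,
        SimpleGraph.Subgraph.sup_adj, Set.mem_union]
      constructor
      · rintro ⟨hv, hw, hvw⟩
        by_contra hcon
        have h1 : ¬ (v ∈ W₁ ∧ w ∈ W₁) := fun h => hcon (Or.inl ⟨h.1, h.2, hvw⟩)
        have h2 : ¬ (v ∈ W₂ ∧ w ∈ W₂) := fun h => hcon (Or.inr ⟨h.1, h.2, hvw⟩)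
        rcases hv with hv | hv <;> rcases hw with hw | hw
        · exact h1 ⟨hv, hw⟩
        · exact hno v ⟨hv, fun h => h2 ⟨h, hw⟩⟩ w ⟨hw, fun h => h1 ⟨hv, h⟩⟩ hvw
        · exact hno w ⟨hw, fun h => h2 ⟨hv, h⟩⟩ v ⟨hv, fun h => h1 ⟨h, hw⟩⟩ hvw.symm
        · exact h2 ⟨hv, hw⟩
      · rintro (⟨hv, hw, hvw⟩ | ⟨hv, hw, hvw⟩)
        · exact ⟨Or.inl hv, Or.inl hw, hvw⟩
        · exact ⟨Or.inr hv, Or.inr hw, hvw⟩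
  rw [heq]
  refine IsCliqueGluing.glue _ _ h₁ h₂ hne ?_
  intro v hv w hw hvw
  exact ⟨⟨hv.1, hw.1, hcl hv hw hvw⟩, ⟨hv.2, hw.2, hcl hv hw hvw⟩⟩

/-- A property of vertex subsets that holds for those with an obstruction-free ranking and passes
to gluings along nonempty cliques holds for all subsets of a generalized split graph without
antiholes. -/
theorem IsGeneralizedSplit.induction_glue [Finite V] (hG : IsGeneralizedSplit G)
    (hA : NoAntiholes G) {P : Set V → Prop}
    (base : ∀ W, (∃ r : V → ℕ, Function.Injective r ∧ ObstructionFree G r W) → P W)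
    (glue : ∀ W₁ W₂, (W₁ ∩ W₂).Nonempty → G.IsClique (W₁ ∩ W₂) →
      (∀ v ∈ W₁ \ W₂, ∀ w ∈ W₂ \ W₁, ¬ G.Adj v w) → P W₁ → P W₂ → P (W₁ ∪ W₂)) (W : Set V) :
    P W := by
  rcases hG with h | h
  · obtain ⟨C, hC⟩ := h.exists_isUnipolarCore
    exact hC.induction_glue hA base glue W
  · obtain ⟨C, hC⟩ := h.exists_isUnipolarCore
    obtain ⟨r, hr, ho⟩ := hC.exists_obstructionFree_of_compl
    exact base W ⟨r, hr, ho.mono (Set.subset_univ W)⟩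

theorem IsGeneralizedSplit.isCliqueGluing_componentSubgraph [Finite V] (hG : IsGeneralizedSplit G)
    (hA : NoAntiholes G) (c : G.ConnectedComponent) : IsCliqueGluing G (componentSubgraph c) :=
  hG.induction_glue hA (P := fun W => IsCliqueGluing G ((⊤ : G.Subgraph).induce W))
    (fun _ ⟨_, hr, ho⟩ => IsCliqueGluing.of_obstructionFree hr ho)
    (fun _ _ hne hcl hno h₁ h₂ => IsCliqueGluing.union hne hcl hno h₁ h₂) c.supp

end CliqueGluing

/-! ### Quadratic weights on stable sets -/

section QuadraticWeight

variable {V : Type u} {G : SimpleGraph V}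

/-- `S` is a stable set of the induced subgraph `G[W]`. -/
def IsStableIn (G : SimpleGraph V) (W : Set V) (S : Finset V) : Prop :=
  (S : Set V) ⊆ W ∧ G.IsIndepSet (S : Set V)

/-- The pair `S, T` has the largest total weight among the pairs of stable sets of `G[W]` that cover
every vertex equally often. -/
def IsMaximalPair (G : SimpleGraph V) (W : Set V) (w : Finset V → ℕ) (S T : Finset V) : Prop :=
  ∀ S' T', IsStableIn G W S' → IsStableIn G W T' → S'.val + T'.val = S.val + T.val →
    w S' + w T' ≤ w S + w T

/-- Families of stable sets of `G[W]` are multisets; a fiber of the toric map consists of the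
families of a given size that cover every vertex a given number of times. The weight `w` is
quadratic if each fiber contains at most one family all of whose pairs are maximal. -/
def IsQuadraticWeight (G : SimpleGraph V) (W : Set V) (w : Finset V → ℕ) : Prop :=
  ∀ P Q : Multiset (Finset V), (∀ S ∈ P, IsStableIn G W S) → (∀ S ∈ Q, IsStableIn G W S) →
    (∀ S ∈ P, ∀ T ∈ P, IsMaximalPair G W w S T) → (∀ S ∈ Q, ∀ T ∈ Q, IsMaximalPair G W w S T) →
    P.card = Q.card → (P.map Finset.val).sum = (Q.map Finset.val).sum → P = Q

theorem val_add_val_eq_iff {S T S' T' : Finset V} :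
    S'.val + T'.val = S.val + T.val ↔ ∀ v, (v ∈ S' ∨ v ∈ T' ↔ v ∈ S ∨ v ∈ T) ∧
      (v ∈ S' ∧ v ∈ T' ↔ v ∈ S ∧ v ∈ T) := by
  classical
  rw [Multiset.ext]
  refine forall_congr' fun v => ?_
  simp only [Multiset.count_add, Multiset.count_eq_of_nodup (Finset.nodup _), Finset.mem_val]
  by_cases h1 : v ∈ S <;> by_cases h2 : v ∈ T <;> by_cases h3 : v ∈ S' <;> by_cases h4 : v ∈ T' <;>
    simp [h1, h2, h3, h4]

theorem sum_add_sum_eq {S T S' T' : Finset V} (h : S'.val + T'.val = S.val + T.val) (f : V → ℕ) :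
    ∑ v ∈ S', f v + ∑ v ∈ T', f v = ∑ v ∈ S, f v + ∑ v ∈ T, f v := by
  have := congrArg (fun M : Multiset V => (M.map f).sum) h
  simp only [Multiset.map_add, Multiset.sum_add] at this
  exact this

theorem mem_sum_map_val {P : Multiset (Finset V)} {v : V} :
    v ∈ (P.map Finset.val).sum ↔ ∃ S ∈ P, v ∈ S := by
  induction P using Multiset.induction_on with
  | empty => simp
  | cons S P ih => simp [ih]

/-- `S` is the set chosen first by greedy coloring among the vertices of `U`: it is stable, and
every other vertex of `U` has an earlier neighbor in `S`. -/
def IsGreedySet (G : SimpleGraph V) (r : V → ℕ) (U S : Finset V) : Prop :=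
  S ⊆ U ∧ G.IsIndepSet (S : Set V) ∧ ∀ v ∈ U, v ∉ S → ∃ u ∈ S, r u < r v ∧ G.Adj u v

theorem IsGreedySet.unique {r : V → ℕ} {U S T : Finset V} (hS : IsGreedySet G r U S)
    (hT : IsGreedySet G r U T) : S = T := by
  have key : ∀ n v, r v = n → (v ∈ S ↔ v ∈ T) := by
    intro n
    induction n using Nat.strong_induction_on with
    | _ n ih =>
      have aux : ∀ {A B : Finset V}, IsGreedySet G r U A → IsGreedySet G r U B →
          (∀ m < n, ∀ v, r v = m → (v ∈ A ↔ v ∈ B)) → ∀ v, r v = n → v ∈ A → v ∈ B := by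
        intro A B hA hB hAB v hv hvA
        by_contra hvB
        obtain ⟨u, hu, hlt, hadj⟩ := hB.2.2 v (hA.1 hvA) hvB
        exact hA.2.1 ((hAB (r u) (hv ▸ hlt) u rfl).2 hu) hvA hadj.ne hadj
      exact fun v hv => ⟨aux hS hT ih v hv, aux hT hS (fun m hm v hv => (ih m hm v hv).symm) v hv⟩
  exact Finset.ext fun v => key _ v rfl

/-- The stable set of largest binary value, earlier vertices being more significant, is greedy. -/
theorem exists_isGreedySet {r b : V → ℕ} (hb : Function.Injective b)
    (hrb : ∀ u v, r u < r v ↔ b v < b u) (U : Finset V) :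
    ∃ S, IsGreedySet G r U S ∧ ∀ T ⊆ U, G.IsIndepSet (T : Set V) →
      ∑ v ∈ T, 2 ^ b v ≤ ∑ v ∈ S, 2 ^ b v := by
  classical
  obtain ⟨S, hS, hmax⟩ := (U.powerset.filter fun T : Finset V => G.IsIndepSet (T : Set V))
    |>.exists_max_image (fun T => ∑ v ∈ T, 2 ^ b v) ⟨∅, by simp [SimpleGraph.IsIndepSet]⟩
  rw [Finset.mem_filter, Finset.mem_powerset] at hS
  refine ⟨S, ⟨hS.1, hS.2, fun v hv hvS => ?_⟩,
    fun T hT hT' => hmax T (Finset.mem_filter.2 ⟨Finset.mem_powerset.2 hT, hT'⟩)⟩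
  by_contra! hcon
  refine absurd (hmax (insert v (S.filter fun u => ¬ G.Adj u v)) ?_) (not_le.2 ?_)
  · rw [Finset.mem_filter, Finset.mem_powerset]
    refine ⟨Finset.insert_subset hv ((Finset.filter_subset _ _).trans hS.1), ?_⟩
    intro x hx y hy hxy hadj
    simp only [Finset.coe_insert, Finset.coe_filter, Set.mem_insert_iff, Set.mem_ofPred_eq] at hx hy
    rcases hx with rfl | hx <;> rcases hy with rfl | hy
    · exact hxy rfl
    · exact hy.2 hadj.symm
    · exact hx.2 hadj
    · exact hS.2 hx.1 hy.1 hxy hadj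
  · refine sum_two_pow_lt_sum_two_pow hb (z := v) (by simp [hvS]) fun u hu => ?_
    simp only [Finset.mem_sdiff, Finset.mem_insert, Finset.mem_filter, not_or, not_and,
      not_not] at hu
    have hadj := hu.2.2 hu.1
    refine lt_of_le_of_ne (not_lt.1 fun hlt => hcon u hu.1 ((hrb u v).2 hlt) hadj) fun e => ?_
    exact hadj.ne (hb e)

/-- A maximal pair for the square of the binary value is a pair of greedy color classes: splitting
`S ∪ T` into its greedy set and the rest gives a pair of stable sets, since an edge in the rest
would extend to an obstruction, and this pair is more spread out. -/
theorem IsMaximalPair.exists_adj {r b : V → ℕ} {W : Set V} (hb : Function.Injective b)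
    (hrb : ∀ u v, r u < r v ↔ b v < b u) (ho : ObstructionFree G r W) {S T : Finset V}
    (hS : IsStableIn G W S) (hT : IsStableIn G W T)
    (h : IsMaximalPair G W (fun S => (∑ v ∈ S, 2 ^ b v) ^ 2) S T)
    (hle : ∑ v ∈ T, 2 ^ b v ≤ ∑ v ∈ S, 2 ^ b v) :
    ∀ v ∈ T, v ∉ S → ∃ u ∈ S, r u < r v ∧ G.Adj u v := by
  classical
  obtain ⟨A, hA, hmax⟩ := exists_isGreedySet (G := G) hb hrb (S ∪ T)
  have hboth : ∀ v ∈ S, v ∈ T → v ∈ A := by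
    intro v hvS hvT
    by_contra hvA
    obtain ⟨u, hu, -, hadj⟩ := hA.2.2 v (Finset.mem_union_left _ hvS) hvA
    rcases Finset.mem_union.1 (hA.1 hu) with hu | hu
    · exact hS.2 hu hvS hadj.ne hadj
    · exact hT.2 hu hvT hadj.ne hadj
  have hUW : ∀ v ∈ S ∪ T, v ∈ W := fun v hv =>
    (Finset.mem_union.1 hv).elim (fun h => hS.1 h) (fun h => hT.1 h)
  set B : Finset V := ((S ∪ T) \ A) ∪ (S ∩ T) with hB
  have hsum : A.val + B.val = S.val + T.val := by
    refine val_add_val_eq_iff.2 fun v => ?_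
    have h1 := hboth v
    have h2 : v ∈ A → v ∈ S ∨ v ∈ T := fun hv => Finset.mem_union.1 (hA.1 hv)
    simp only [hB, Finset.mem_union, Finset.mem_sdiff, Finset.mem_inter]
    tauto
  have key : ∀ x ∈ S, ∀ y ∈ T, x ∉ A → y ∉ A → ¬ G.Adj x y := by
    intro x hx y hy hxA hyA hxy
    obtain ⟨x', hx', hlx, hax⟩ := hA.2.2 x (Finset.mem_union_left _ hx) hxA
    obtain ⟨y', hy', hly, hay⟩ := hA.2.2 y (Finset.mem_union_right _ hy) hyA
    have hx'T : x' ∈ T := (Finset.mem_union.1 (hA.1 hx')).resolve_left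
      fun h => hS.2 h hx hax.ne hax
    have hy'S : y' ∈ S := (Finset.mem_union.1 (hA.1 hy')).resolve_right
      fun h => hT.2 h hy hay.ne hay
    refine ho x' (hUW _ (hA.1 hx')) x (hS.1 hx) y (hT.1 hy) y' (hUW _ (hA.1 hy')) hax hxy
      hay.symm (fun h => hT.2 hx'T hy h.ne h) (fun h => hA.2.1 hx' hy' h.ne h)
      (fun h => hS.2 hx hy'S h.ne h) hlx hly
  have hBst : IsStableIn G W B := by
    refine ⟨fun v hv => hUW v ?_, ?_⟩
    · simp only [hB, Finset.coe_union, Finset.coe_sdiff, Finset.coe_inter, Set.mem_union,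
        Set.mem_sdiff, Set.mem_inter_iff, Finset.mem_coe] at hv
      rw [Finset.mem_union]
      tauto
    · intro x hx y hy hne hxy
      have hmem : ∀ z ∈ B, (z ∈ S ∨ z ∈ T) ∧ (z ∈ A → z ∈ S ∧ z ∈ T) := by
        intro z hz
        simp only [hB, Finset.mem_union, Finset.mem_sdiff, Finset.mem_inter] at hz
        tauto
      have hSS : x ∈ S → y ∈ S → False := fun h h' => hS.2 h h' hne hxy
      have hTT : x ∈ T → y ∈ T → False := fun h h' => hT.2 h h' hne hxy
      obtain ⟨hx1, hx2⟩ := hmem x hx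
      obtain ⟨hy1, hy2⟩ := hmem y hy
      rcases hx1 with hx1 | hx1 <;> rcases hy1 with hy1 | hy1
      · exact hSS hx1 hy1
      · exact key x hx1 y hy1 (fun hA => hTT (hx2 hA).2 hy1) (fun hA => hSS hx1 (hy2 hA).1) hxy
      · exact key y hy1 x hx1 (fun hA => hTT hx1 (hy2 hA).2) (fun hA => hSS (hx2 hA).1 hy1) hxy.symm
      · exact hTT hx1 hy1
  have h1 := h A B ⟨fun v hv => hUW v (hA.1 hv), hA.2.1⟩ hBst hsum
  have h2 := sum_add_sum_eq hsum (fun v => 2 ^ b v)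
  have h3 := hmax S Finset.subset_union_left hS.2
  simp only at h1
  have hAS : A = S := by
    have hval : ∑ v ∈ A, 2 ^ b v = ∑ v ∈ S, 2 ^ b v := by
      generalize ∑ v ∈ A, 2 ^ b v = a' at *
      generalize ∑ v ∈ B, 2 ^ b v = c' at *
      generalize ∑ v ∈ S, 2 ^ b v = a at *
      generalize ∑ v ∈ T, 2 ^ b v = c at *
      obtain ⟨d, rfl⟩ := Nat.exists_eq_add_of_le h3
      obtain ⟨e, rfl⟩ := Nat.exists_eq_add_of_le hle
      have : c = c' + d := by omega
      subst this
      have : d * d = 0 := by nlinarith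
      have : d = 0 := by simpa using this
      omega
    have := Finset.geomSum_injective (n := 2) le_rfl (a₁ := A.map ⟨b, hb⟩) (a₂ := S.map ⟨b, hb⟩)
      (by simpa using hval)
    exact Finset.map_injective _ this
  intro v hv hvS
  rw [← hAS] at hvS ⊢
  exact hA.2.2 v (Finset.mem_union_right _ hv) hvS

/-- The square of the binary value is a quadratic weight: a family with maximal pairs is a greedy
coloring of the vertices it covers, counted with multiplicity. -/
theorem ObstructionFree.exists_isQuadraticWeight [Finite V] {r : V → ℕ} {W : Set V}
    (hr : Function.Injective r) (ho : ObstructionFree G r W) :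
    ∃ w, IsQuadraticWeight G W w := by
  classical
  have := Fintype.ofFinite V
  obtain ⟨b, hb, hrb⟩ : ∃ b : V → ℕ, Function.Injective b ∧ ∀ u v, r u < r v ↔ b v < b u := by
    have hle : ∀ v, r v ≤ Finset.univ.sup r := fun v => Finset.le_sup (Finset.mem_univ v)
    refine ⟨fun v => Finset.univ.sup r - r v, fun u v e => hr ?_, fun u v => ?_⟩
    · have := hle u; have := hle v; simp only at e; omega
    · have := hle u; have := hle v; simp only; omega
  refine ⟨fun S => (∑ v ∈ S, 2 ^ b v) ^ 2, ?_⟩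
  intro P
  induction hn : P.card generalizing P with
  | zero =>
    intro Q _ _ _ _ hc _
    rw [Multiset.card_eq_zero.1 hn, Multiset.card_eq_zero.1 hc.symm]
  | succ n ih =>
    intro Q hP hQ hmP hmQ hc hs
    have first : ∀ R : Multiset (Finset V), R.card = n + 1 → (∀ S ∈ R, IsStableIn G W S) →
        (∀ S ∈ R, ∀ T ∈ R, IsMaximalPair G W (fun S => (∑ v ∈ S, 2 ^ b v) ^ 2) S T) →
        ∃ S ∈ R, IsGreedySet G r (R.map Finset.val).sum.toFinset S := by
      intro R hR hst hm
      have hmem : ∀ v, v ∈ (R.map Finset.val).sum.toFinset ↔ ∃ T ∈ R, v ∈ T := by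
        intro v
        rw [Multiset.mem_toFinset, mem_sum_map_val]
      obtain ⟨S, hS, hmax⟩ := R.toFinset.exists_max_image (fun S => ∑ v ∈ S, 2 ^ b v) (by
        obtain ⟨S, hS⟩ := Multiset.card_pos_iff_exists_mem.1 (show 0 < R.card by omega)
        exact ⟨S, Multiset.mem_toFinset.2 hS⟩)
      have hS := Multiset.mem_toFinset.1 hS
      refine ⟨S, hS, fun v hv => (hmem v).2 ⟨S, hS, hv⟩, (hst S hS).2, fun v hv hvS => ?_⟩
      obtain ⟨T, hT, hvT⟩ := (hmem v).1 hv
      exact (hm S hS T hT).exists_adj hb hrb ho (hst S hS) (hst T hT)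
        (hmax T (Multiset.mem_toFinset.2 hT)) v hvT hvS
    obtain ⟨S, hSP, hS⟩ := first P hn hP hmP
    obtain ⟨T, hTQ, hT⟩ := first Q hc.symm hQ hmQ
    rw [← hs] at hT
    obtain rfl := hS.unique hT
    rw [← Multiset.cons_erase hSP, ← Multiset.cons_erase hTQ] at hs ⊢
    have hcP := Multiset.card_erase_of_mem hSP
    have hcQ := Multiset.card_erase_of_mem hTQ
    simp only [Multiset.map_cons, Multiset.sum_cons, add_right_inj] at hs
    rw [ih (P.erase S) (by rw [hcP, hn]; rfl) (Q.erase S)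
      (fun A hA => hP A (Multiset.mem_of_mem_erase hA))
      (fun A hA => hQ A (Multiset.mem_of_mem_erase hA))
      (fun A hA B hB => hmP A (Multiset.mem_of_mem_erase hA) B (Multiset.mem_of_mem_erase hB))
      (fun A hA B hB => hmQ A (Multiset.mem_of_mem_erase hA) B (Multiset.mem_of_mem_erase hB))
      (by rw [hcQ, ← hc]; rfl) hs]

end QuadraticWeight

/-! ### Gluing quadratic weights along a clique -/

section WeightGluing

variable {V : Type u} {G : SimpleGraph V}

open Classical in
/-- The part of `S` inside `W`. -/
def restrictTo (W : Set V) (S : Finset V) : Finset V := S.filter (· ∈ W)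

theorem mem_restrictTo {W : Set V} {S : Finset V} {v : V} :
    v ∈ restrictTo W S ↔ v ∈ S ∧ v ∈ W := by
  classical
  exact Finset.mem_filter

theorem IsStableIn.restrictTo {W W' : Set V} {S : Finset V} (h : IsStableIn G W S) :
    IsStableIn G W' (restrictTo W' S) :=
  ⟨fun _ hv => (mem_restrictTo.1 hv).2,
    fun _ hv _ hw => h.2 (mem_restrictTo.1 hv).1 (mem_restrictTo.1 hw).1⟩

theorem sum_map_val_restrictTo (W : Set V) {P Q : Multiset (Finset V)}
    (h : (P.map Finset.val).sum = (Q.map Finset.val).sum) :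
    ((P.map (restrictTo W)).map Finset.val).sum = ((Q.map (restrictTo W)).map Finset.val).sum := by
  classical
  have key : ∀ R : Multiset (Finset V), ((R.map (restrictTo W)).map Finset.val).sum =
      ((R.map Finset.val).sum).filter (· ∈ W) := by
    intro R
    induction R using Multiset.induction_on with
    | empty => simp
    | cons S R ih =>
      simp only [Multiset.map_cons, Multiset.sum_cons, Multiset.filter_add, ih]
      congr 1
  rw [key, key, h]

section Glue

variable {W₁ W₂ : Set V}

theorem IsStableIn.union [DecidableEq V] (hno : ∀ v ∈ W₁ \ W₂, ∀ w ∈ W₂ \ W₁, ¬ G.Adj v w)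
    {A B : Finset V} (hA : IsStableIn G W₁ A) (hB : IsStableIn G W₂ B)
    (hAB : ∀ v ∈ W₁ ∩ W₂, (v ∈ A ↔ v ∈ B)) :
    IsStableIn G (W₁ ∪ W₂) (A ∪ B) ∧ StableSetToric.restrictTo W₁ (A ∪ B) = A ∧
      StableSetToric.restrictTo W₂ (A ∪ B) = B := by
  have key : ∀ x ∈ A, ∀ y ∈ B, ¬ G.Adj x y := by
    intro x hx y hy hxy
    by_cases hx2 : x ∈ W₂
    · exact hB.2 ((hAB x ⟨hA.1 hx, hx2⟩).1 hx) hy hxy.ne hxy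
    · by_cases hy1 : y ∈ W₁
      · exact hA.2 hx ((hAB y ⟨hy1, hB.1 hy⟩).2 hy) hxy.ne hxy
      · exact hno x ⟨hA.1 hx, hx2⟩ y ⟨hB.1 hy, hy1⟩ hxy
  refine ⟨⟨?_, ?_⟩, ?_, ?_⟩
  · rw [Finset.coe_union]
    exact Set.union_subset_union hA.1 hB.1
  · intro x hx y hy hne hxy
    rcases Finset.mem_union.1 hx with hx | hx <;> rcases Finset.mem_union.1 hy with hy | hy
    · exact hA.2 hx hy hne hxy
    · exact key x hx y hy hxy
    · exact key y hy x hx hxy.symm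
    · exact hB.2 hx hy hne hxy
  · ext v
    rw [mem_restrictTo, Finset.mem_union]
    have h1 : v ∈ A → v ∈ W₁ := fun h => hA.1 h
    have h2 : v ∈ B → v ∈ W₂ := fun h => hB.1 h
    have h3 := hAB v
    simp only [Set.mem_inter_iff] at h3
    tauto
  · ext v
    rw [mem_restrictTo, Finset.mem_union]
    have h1 : v ∈ A → v ∈ W₁ := fun h => hA.1 h
    have h2 : v ∈ B → v ∈ W₂ := fun h => hB.1 h
    have h3 := hAB v
    simp only [Set.mem_inter_iff] at h3
    tauto

/-- A stable set contains at most one vertex of the clique `W₁ ∩ W₂`, so another pair of stable sets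
of `G[W₁]` with the same union as the restrictions of `S, T` meets the clique in the same way, up to
the order of the pair. -/
theorem IsStableIn.agree_or_agree (hcl : G.IsClique (W₁ ∩ W₂)) {S T S₁ T₁ : Finset V}
    (hS : IsStableIn G (W₁ ∪ W₂) S) (hT : IsStableIn G (W₁ ∪ W₂) T) (hS₁ : IsStableIn G W₁ S₁)
    (hT₁ : IsStableIn G W₁ T₁)
    (h : S₁.val + T₁.val = (StableSetToric.restrictTo W₁ S).val +
      (StableSetToric.restrictTo W₁ T).val) :
    (∀ v ∈ W₁ ∩ W₂, (v ∈ S₁ ↔ v ∈ S) ∧ (v ∈ T₁ ↔ v ∈ T)) ∨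
      (∀ v ∈ W₁ ∩ W₂, (v ∈ S₁ ↔ v ∈ T) ∧ (v ∈ T₁ ↔ v ∈ S)) := by
  rw [val_add_val_eq_iff] at h
  simp only [mem_restrictTo] at h
  have one : ∀ {A : Finset V}, G.IsIndepSet (A : Set V) → ∀ x ∈ W₁ ∩ W₂, ∀ y ∈ W₁ ∩ W₂,
      x ∈ A → y ∈ A → x = y := by
    intro A hA x hx y hy hxA hyA
    by_contra hne
    exact hA hxA hyA hne (hcl hx hy hne)
  by_cases hex : ∃ v ∈ W₁ ∩ W₂, v ∈ S₁
  · obtain ⟨v, hv, hvS⟩ := hex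
    rcases ((h v).1.1 (Or.inl hvS)) with hvS' | hvT'
    · left
      intro x hx
      have h1 : x ∈ S₁ ↔ x ∈ S := ⟨fun hxS => one hS₁.2 v hv x hx hvS hxS ▸ hvS'.1,
        fun hxS => one hS.2 v hv x hx hvS'.1 hxS ▸ hvS⟩
      have hx1 := hx.1
      have := h x
      tauto
    · right
      intro x hx
      have h1 : x ∈ S₁ ↔ x ∈ T := ⟨fun hxS => one hS₁.2 v hv x hx hvS hxS ▸ hvT'.1,
        fun hxS => one hT.2 v hv x hx hvT'.1 hxS ▸ hvS⟩
      have hx1 := hx.1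
      have := h x
      tauto
  · push Not at hex
    by_cases hex' : ∃ v ∈ W₁ ∩ W₂, v ∈ S
    · obtain ⟨v, hv, hvS⟩ := hex'
      right
      have hvT₁ : v ∈ T₁ := ((h v).1.2 (Or.inl ⟨hvS, hv.1⟩)).resolve_left (hex v hv)
      intro x hx
      have hT' : x ∉ T := by
        intro hxT
        have hxT₁ : x ∈ T₁ := ((h x).1.2 (Or.inr ⟨hxT, hx.1⟩)).resolve_left (hex x hx)
        obtain rfl := one hT₁.2 v hv x hx hvT₁ hxT₁
        exact hex v hv ((h v).2.2 ⟨⟨hvS, hv.1⟩, hxT, hv.1⟩).1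
      have h0 := hex x hx
      have hx1 := hx.1
      have := h x
      tauto
    · push Not at hex'
      left
      intro x hx
      have h0 := hex x hx
      have h1 := hex' x hx
      have hx1 := hx.1
      have := h x
      tauto

/-- Exchanging the parts of a pair inside `W₁` lifts to an exchange in `W₁ ∪ W₂` that does not
affect the parts inside `W₂`. -/
theorem IsStableIn.exists_lift (hcl : G.IsClique (W₁ ∩ W₂))
    (hno : ∀ v ∈ W₁ \ W₂, ∀ w ∈ W₂ \ W₁, ¬ G.Adj v w) {S T S₁ T₁ : Finset V}
    (hS : IsStableIn G (W₁ ∪ W₂) S) (hT : IsStableIn G (W₁ ∪ W₂) T) (hS₁ : IsStableIn G W₁ S₁)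
    (hT₁ : IsStableIn G W₁ T₁)
    (h : S₁.val + T₁.val = (StableSetToric.restrictTo W₁ S).val +
      (StableSetToric.restrictTo W₁ T).val) :
    ∃ S' T', IsStableIn G (W₁ ∪ W₂) S' ∧ IsStableIn G (W₁ ∪ W₂) T' ∧
      S'.val + T'.val = S.val + T.val ∧ StableSetToric.restrictTo W₁ S' = S₁ ∧
      StableSetToric.restrictTo W₁ T' = T₁ ∧
      ∀ w : Finset V → ℕ,
        w (StableSetToric.restrictTo W₂ S') + w (StableSetToric.restrictTo W₂ T') =
          w (StableSetToric.restrictTo W₂ S) + w (StableSetToric.restrictTo W₂ T) := by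
  classical
  have main : ∀ {A B : Finset V}, IsStableIn G (W₁ ∪ W₂) A → IsStableIn G (W₁ ∪ W₂) B →
      S₁.val + T₁.val = (StableSetToric.restrictTo W₁ A).val +
        (StableSetToric.restrictTo W₁ B).val →
      (∀ v ∈ W₁ ∩ W₂, (v ∈ S₁ ↔ v ∈ A) ∧ (v ∈ T₁ ↔ v ∈ B)) →
      ∃ S' T', IsStableIn G (W₁ ∪ W₂) S' ∧ IsStableIn G (W₁ ∪ W₂) T' ∧
        S'.val + T'.val = A.val + B.val ∧ StableSetToric.restrictTo W₁ S' = S₁ ∧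
        StableSetToric.restrictTo W₁ T' = T₁ ∧
        StableSetToric.restrictTo W₂ S' = StableSetToric.restrictTo W₂ A ∧
        StableSetToric.restrictTo W₂ T' = StableSetToric.restrictTo W₂ B := by
    intro A B hA hB hAB hD
    obtain ⟨h1, h2, h3⟩ := hS₁.union hno (hA.restrictTo (W' := W₂)) (fun v hv => by
      rw [mem_restrictTo, (hD v hv).1]; exact ⟨fun h => ⟨h, hv.2⟩, And.left⟩)
    obtain ⟨h4, h5, h6⟩ := hT₁.union hno (hB.restrictTo (W' := W₂)) (fun v hv => by
      rw [mem_restrictTo, (hD v hv).2]; exact ⟨fun h => ⟨h, hv.2⟩, And.left⟩)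
    refine ⟨_, _, h1, h4, ?_, h2, h5, h3, h6⟩
    rw [val_add_val_eq_iff] at hAB ⊢
    intro v
    have hv := hAB v
    have hvA : v ∈ A → v ∈ W₁ ∨ v ∈ W₂ := fun h => hA.1 h
    have hvB : v ∈ B → v ∈ W₁ ∨ v ∈ W₂ := fun h => hB.1 h
    have hvS : v ∈ S₁ → v ∈ W₁ := fun h => hS₁.1 h
    have hvT : v ∈ T₁ → v ∈ W₁ := fun h => hT₁.1 h
    have hvD := hD v
    simp only [mem_restrictTo, Finset.mem_union, Set.mem_inter_iff] at hv hvD ⊢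
    clear * - hv hvA hvB hvS hvT hvD
    grind
  rcases hS.agree_or_agree hcl hT hS₁ hT₁ h with hD | hD
  · obtain ⟨S', T', h1, h2, h3, h4, h5, h6, h7⟩ := main hS hT h hD
    exact ⟨S', T', h1, h2, h3, h4, h5, fun w => by rw [h6, h7]⟩
  · obtain ⟨S', T', h1, h2, h3, h4, h5, h6, h7⟩ := main hT hS (h.trans (add_comm _ _)) hD
    exact ⟨S', T', h1, h2, h3.trans (add_comm _ _), h4, h5, fun w => by rw [h6, h7, add_comm]⟩

end Glue

/-- A multiset of pairs that is a chain in the product order within each class of `κ` is determined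
by the multisets of its two coordinates `f` and `g`, each of which determines the class. -/
theorem multiset_eq_of_map_eq_of_chain {α γ : Type*} (f g : α → ℕ) (κ : α → γ)
    (hf : ∀ x y, f x = f y → κ x = κ y) (P Q : Multiset α)
    (hinj : ∀ x ∈ P, ∀ y ∈ Q, f x = f y → g x = g y → x = y)
    (hg : ∀ x y, g x = g y → κ x = κ y)
    (hP : ∀ x ∈ P, ∀ y ∈ P, κ x = κ y → f x < f y → g x ≤ g y)
    (hQ : ∀ x ∈ Q, ∀ y ∈ Q, κ x = κ y → f x < f y → g x ≤ g y)
    (h1 : P.map f = Q.map f) (h2 : P.map g = Q.map g) : P = Q := by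
  classical
  induction hn : P.card generalizing P Q with
  | zero =>
    obtain rfl := Multiset.card_eq_zero.1 hn
    exact (Multiset.map_eq_zero.1 h1.symm).symm
  | succ n ih =>
    obtain ⟨z, hz⟩ := Multiset.card_pos_iff_exists_mem.1 (show 0 < P.card by omega)
    obtain ⟨z', hz', hzz⟩ := Multiset.mem_map.1 (h1 ▸ Multiset.mem_map_of_mem f hz)
    -- The least element of a class is least in both coordinates.
    have least : ∀ R : Multiset α, (∀ x ∈ R, ∀ y ∈ R, κ x = κ y → f x < f y → g x ≤ g y) →
        (∃ x ∈ R, κ x = κ z) → ∃ x ∈ R, κ x = κ z ∧ ∀ y ∈ R, κ y = κ z → f x ≤ f y ∧ g x ≤ g y := by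
      rintro R hR ⟨x, hx, hxz⟩
      obtain ⟨m, hm, hmin⟩ := (R.toFinset.filter fun x => κ x = κ z).exists_min_image
        (fun x => f x + g x) ⟨x, by simp [hx, hxz]⟩
      simp only [Finset.mem_filter, Multiset.mem_toFinset] at hm hmin
      refine ⟨m, hm.1, hm.2, fun y hy hyz => ?_⟩
      have hle := hmin y ⟨hy, hyz⟩
      rcases lt_trichotomy (f m) (f y) with h | h | h
      · exact ⟨h.le, hR m hm.1 y hy (hm.2.trans hyz.symm) h⟩
      · exact ⟨h.le, by omega⟩
      · have := hR y hy m hm.1 (hyz.trans hm.2.symm) h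
        omega
    obtain ⟨x, hx, hxz, hxm⟩ := least P hP ⟨z, hz, rfl⟩
    obtain ⟨y, hy, hyz, hym⟩ := least Q hQ ⟨z', hz', hf _ _ hzz⟩
    have hfxy : f x = f y := by
      obtain ⟨y', hy', e⟩ := Multiset.mem_map.1 (h1 ▸ Multiset.mem_map_of_mem f hx)
      obtain ⟨x', hx', e'⟩ := Multiset.mem_map.1 (h1.symm ▸ Multiset.mem_map_of_mem f hy)
      exact le_antisymm (e' ▸ (hxm x' hx' ((hf _ _ e').trans hyz)).1)
        (e ▸ (hym y' hy' ((hf _ _ e).trans hxz)).1)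
    have hgxy : g x = g y := by
      obtain ⟨y', hy', e⟩ := Multiset.mem_map.1 (h2 ▸ Multiset.mem_map_of_mem g hx)
      obtain ⟨x', hx', e'⟩ := Multiset.mem_map.1 (h2.symm ▸ Multiset.mem_map_of_mem g hy)
      exact le_antisymm (e' ▸ (hxm x' hx' ((hg _ _ e').trans hyz)).2)
        (e ▸ (hym y' hy' ((hg _ _ e).trans hxz)).2)
    obtain rfl := hinj x hx y hy hfxy hgxy
    have hc := Multiset.card_erase_of_mem hx
    rw [← Multiset.cons_erase hx, ← Multiset.cons_erase hy] at h1 h2 ⊢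
    simp only [Multiset.map_cons, Multiset.cons_inj_right] at h1 h2
    rw [ih (P.erase x) (Q.erase x)
      (fun a ha b hb => hinj a (Multiset.mem_of_mem_erase ha) b (Multiset.mem_of_mem_erase hb))
      (fun a ha b hb => hP a (Multiset.mem_of_mem_erase ha) b (Multiset.mem_of_mem_erase hb))
      (fun a ha b hb => hQ a (Multiset.mem_of_mem_erase ha) b (Multiset.mem_of_mem_erase hb))
      h1 h2 (by rw [hc, hn]; rfl)]

/-- Gluing along a clique: the weights of the two parts are added, and a much smaller strictly
convex term sorts the two parts of the stable sets that agree on the clique. -/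
theorem exists_isQuadraticWeight_union [Finite V] {W₁ W₂ : Set V} (hcl : G.IsClique (W₁ ∩ W₂))
    (hno : ∀ v ∈ W₁ \ W₂, ∀ w ∈ W₂ \ W₁, ¬ G.Adj v w) (h₁ : ∃ w, IsQuadraticWeight G W₁ w)
    (h₂ : ∃ w, IsQuadraticWeight G W₂ w) : ∃ w, IsQuadraticWeight G (W₁ ∪ W₂) w := by
  classical
  obtain ⟨w₁, h₁⟩ := h₁
  obtain ⟨w₂, h₂⟩ := h₂
  obtain ⟨n, ⟨e⟩⟩ := Finite.exists_equiv_fin (Finset V)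
  let f : Finset V → ℕ := fun S => e (restrictTo W₁ S)
  let g : Finset V → ℕ := fun S => e (restrictTo W₂ S)
  let p : Finset V → ℕ := fun S => w₁ (restrictTo W₁ S) + w₂ (restrictTo W₂ S)
  let q : Finset V → ℕ := fun S => (f S + g S) ^ 2
  have hq : ∀ S, q S ≤ (2 * n) ^ 2 := fun S => by
    have hfS : f S < n := (e (restrictTo W₁ S)).2
    have hgS : g S < n := (e (restrictTo W₂ S)).2
    exact Nat.pow_le_pow_left (by omega) 2
  obtain ⟨M, hM⟩ : ∃ M, M = 2 * (2 * n) ^ 2 + 1 := ⟨_, rfl⟩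
  let w : Finset V → ℕ := fun S => M * p S + q S
  have hfeq : ∀ {S T}, f S = f T → restrictTo W₁ S = restrictTo W₁ T :=
    fun h => e.injective (Fin.ext h)
  have hgeq : ∀ {S T}, g S = g T → restrictTo W₂ S = restrictTo W₂ T :=
    fun h => e.injective (Fin.ext h)
  have hprim : ∀ {S T S' T'}, IsMaximalPair G (W₁ ∪ W₂) w S T → IsStableIn G (W₁ ∪ W₂) S' →
      IsStableIn G (W₁ ∪ W₂) T' → S'.val + T'.val = S.val + T.val → p S' + p T' ≤ p S + p T := by
    intro S T S' T' h hS' hT' hsum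
    have h0 := h S' T' hS' hT' hsum
    have h1 := hq S
    have h2 := hq T
    simp only [w] at h0
    by_contra! hlt
    have h3 := Nat.mul_le_mul_left M (Nat.succ_le_of_lt hlt)
    rw [Nat.succ_eq_add_one] at h3
    linarith
  have hsec : ∀ {S T S' T'}, IsMaximalPair G (W₁ ∪ W₂) w S T → IsStableIn G (W₁ ∪ W₂) S' →
      IsStableIn G (W₁ ∪ W₂) T' → S'.val + T'.val = S.val + T.val → p S' + p T' = p S + p T →
      q S' + q T' ≤ q S + q T := by
    intro S T S' T' h hS' hT' hsum hp
    have h0 := h S' T' hS' hT' hsum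
    have h3 : M * (p S' + p T') = M * (p S + p T) := by rw [hp]
    simp only [w] at h0
    linarith
  have hmax₁ : ∀ {S T}, IsStableIn G (W₁ ∪ W₂) S → IsStableIn G (W₁ ∪ W₂) T →
      IsMaximalPair G (W₁ ∪ W₂) w S T →
      IsMaximalPair G W₁ w₁ (restrictTo W₁ S) (restrictTo W₁ T) := by
    intro S T hS hT h S₁ T₁ hS₁ hT₁ hsum
    obtain ⟨S', T', hS', hT', hsum', rfl, rfl, hw⟩ := hS.exists_lift hcl hno hT hS₁ hT₁ hsum
    have := hprim h hS' hT' hsum'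
    have := hw w₂
    simp only [p] at *
    omega
  have hmax₂ : ∀ {S T}, IsStableIn G (W₁ ∪ W₂) S → IsStableIn G (W₁ ∪ W₂) T →
      IsMaximalPair G (W₁ ∪ W₂) w S T →
      IsMaximalPair G W₂ w₂ (restrictTo W₂ S) (restrictTo W₂ T) := by
    intro S T hS hT h S₁ T₁ hS₁ hT₁ hsum
    rw [Set.union_comm] at hS hT
    obtain ⟨S', T', hS', hT', hsum', rfl, rfl, hw⟩ := hS.exists_lift
      (by rwa [Set.inter_comm]) (fun v hv w hw hvw => hno w hw v hv hvw.symm) hT hS₁ hT₁ hsum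
    rw [Set.union_comm] at hS' hT'
    have := hprim h hS' hT' hsum'
    have := hw w₁
    simp only [p] at *
    omega
  have hchain : ∀ {S T}, IsStableIn G (W₁ ∪ W₂) S → IsStableIn G (W₁ ∪ W₂) T →
      IsMaximalPair G (W₁ ∪ W₂) w S T → restrictTo (W₁ ∩ W₂) S = restrictTo (W₁ ∩ W₂) T →
      f S < f T → g S ≤ g T := by
    intro S T hS hT h hD hlt
    have hD' : ∀ v ∈ W₁ ∩ W₂, (v ∈ S ↔ v ∈ T) := by
      intro v hv
      have := Finset.ext_iff.1 hD v
      simpa only [mem_restrictTo, hv, and_true] using this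
    have hSU : ∀ v ∈ S, v ∈ W₁ ∨ v ∈ W₂ := fun v hv => hS.1 hv
    have hTU : ∀ v ∈ T, v ∈ W₁ ∨ v ∈ W₂ := fun v hv => hT.1 hv
    obtain ⟨a1, a2, a3⟩ := (hS.restrictTo (W' := W₁)).union hno (hT.restrictTo (W' := W₂))
      (fun v hv => by simp only [mem_restrictTo, hv.1, hv.2, and_true, hD' v hv])
    obtain ⟨b1, b2, b3⟩ := (hT.restrictTo (W' := W₁)).union hno (hS.restrictTo (W' := W₂))
      (fun v hv => by simp only [mem_restrictTo, hv.1, hv.2, and_true, hD' v hv])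
    have := hsec h a1 b1 (by
        rw [val_add_val_eq_iff]
        intro v
        have h1 := hD' v
        have h2 := hSU v
        have h3 := hTU v
        simp only [mem_restrictTo, Finset.mem_union, Set.mem_inter_iff] at h1 ⊢
        clear * - h1 h2 h3
        grind)
      (by simp only [p, a2, a3, b2, b3]; omega)
    simp only [q, f, g, a2, a3, b2, b3] at this hlt ⊢
    by_contra! hcon
    nlinarith
  refine ⟨w, fun P Q hP hQ hmP hmQ hc hs => ?_⟩
  have hPQ₁ : P.map (restrictTo W₁) = Q.map (restrictTo W₁) := by
    refine h₁ _ _ ?_ ?_ ?_ ?_ (by simpa using hc) (sum_map_val_restrictTo W₁ hs)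
    · exact Multiset.forall_mem_map_iff.2 fun S hS => (hP S hS).restrictTo
    · exact Multiset.forall_mem_map_iff.2 fun S hS => (hQ S hS).restrictTo
    · exact Multiset.forall_mem_map_iff.2 fun S hS => Multiset.forall_mem_map_iff.2 fun T hT =>
        hmax₁ (hP S hS) (hP T hT) (hmP S hS T hT)
    · exact Multiset.forall_mem_map_iff.2 fun S hS => Multiset.forall_mem_map_iff.2 fun T hT =>
        hmax₁ (hQ S hS) (hQ T hT) (hmQ S hS T hT)
  have hPQ₂ : P.map (restrictTo W₂) = Q.map (restrictTo W₂) := by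
    refine h₂ _ _ ?_ ?_ ?_ ?_ (by simpa using hc) (sum_map_val_restrictTo W₂ hs)
    · exact Multiset.forall_mem_map_iff.2 fun S hS => (hP S hS).restrictTo
    · exact Multiset.forall_mem_map_iff.2 fun S hS => (hQ S hS).restrictTo
    · exact Multiset.forall_mem_map_iff.2 fun S hS => Multiset.forall_mem_map_iff.2 fun T hT =>
        hmax₂ (hP S hS) (hP T hT) (hmP S hS T hT)
    · exact Multiset.forall_mem_map_iff.2 fun S hS => Multiset.forall_mem_map_iff.2 fun T hT =>
        hmax₂ (hQ S hS) (hQ T hT) (hmQ S hS T hT)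
  have hmem : ∀ {W : Set V} {S T : Finset V}, restrictTo W S = restrictTo W T → ∀ v ∈ W,
      (v ∈ S ↔ v ∈ T) := by
    intro W S T h v hv
    have := Finset.ext_iff.1 h v
    simpa only [mem_restrictTo, hv, and_true] using this
  have hsub : ∀ {W W' : Set V} {S T : Finset V}, W' ⊆ W → restrictTo W S = restrictTo W T →
      restrictTo W' S = restrictTo W' T := by
    intro W W' S T hW h
    ext v
    rw [mem_restrictTo, mem_restrictTo]
    exact and_congr_left fun hv => hmem h v (hW hv)
  refine multiset_eq_of_map_eq_of_chain f g (restrictTo (W₁ ∩ W₂))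
    (fun S T h => hsub Set.inter_subset_left (hfeq h)) P Q ?_
    (fun S T h => hsub Set.inter_subset_right (hgeq h))
    (fun S hS T hT => hchain (hP S hS) (hP T hT) (hmP S hS T hT))
    (fun S hS T hT => hchain (hQ S hS) (hQ T hT) (hmQ S hS T hT)) ?_ ?_
  · intro S hS T hT h1 h2
    ext v
    have h1' := hmem (hfeq h1) v
    have h2' := hmem (hgeq h2) v
    constructor
    · intro hv
      rcases (hP S hS).1 hv with h | h
      · exact (h1' h).1 hv
      · exact (h2' h).1 hv
    · intro hv
      rcases (hQ T hT).1 hv with h | h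
      · exact (h1' h).2 hv
      · exact (h2' h).2 hv
  · have := congrArg (Multiset.map fun S => (e S : ℕ)) hPQ₁
    rw [Multiset.map_map, Multiset.map_map] at this
    exact this
  · have := congrArg (Multiset.map fun S => (e S : ℕ)) hPQ₂
    rw [Multiset.map_map, Multiset.map_map] at this
    exact this

theorem IsGeneralizedSplit.exists_isQuadraticWeight [Finite V] (hG : IsGeneralizedSplit G)
    (hA : NoAntiholes G) (W : Set V) : ∃ w, IsQuadraticWeight G W w :=
  hG.induction_glue hA (P := fun W => ∃ w, IsQuadraticWeight G W w)
    (fun _ ⟨_, hr, ho⟩ => ho.exists_isQuadraticWeight hr)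
    (fun _ _ _ hcl hno h₁ h₂ => exists_isQuadraticWeight_union hcl hno h₁ h₂) W

end WeightGluing

/-! ### Quadratic Gröbner bases of toric ideals -/

section Groebner

open MvPolynomial

/-- Weight functions are refined to monomial orders: compare the weights, break ties
lexicographically. -/
theorem exists_monomialOrder_of_weight {σ : Type u} [Finite σ] (W : (σ →₀ ℕ) →+ ℕ) :
    ∃ m : MonomialOrder.{u, u} σ, ∀ a b, W a < W b → m.toSyn a < m.toSyn b := by
  obtain ⟨n, ⟨e⟩⟩ := Finite.exists_equiv_fin σ
  let _ : LinearOrder σ := LinearOrder.lift' e e.injective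
  let F : (σ →₀ ℕ) →+ ℕ ×ₗ Lex (σ →₀ ℕ) :=
    { toFun := fun a => toLex (W a, toLex a)
      map_zero' := by simp
      map_add' := fun a b => by simp; rfl }
  have hF : Function.LeftInverse (fun p : ℕ ×ₗ Lex (σ →₀ ℕ) => ofLex (ofLex p).2) F :=
    fun _ => rfl
  refine ⟨{ syn := AddMonoidHom.mrange F
            toSyn := AddEquiv.ofLeftInverse' F hF
            toSyn_monotone := ?_ }, ?_⟩
  · intro a b hab
    obtain ⟨c, rfl⟩ := exists_add_of_le hab
    change F a ≤ F (a + c)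
    rw [Prod.Lex.le_iff]
    rcases Nat.eq_zero_or_pos (W c) with h | h
    · exact Or.inr ⟨by simp [F, h], Finsupp.toLex_monotone hab⟩
    · exact Or.inl (by simp [F, h])
  · intro a b hab
    change F a < F b
    rw [Prod.Lex.lt_iff]
    exact Or.inl hab

variable {σ : Type u} {τ : Type*} {K : Type v} [Field K] {φ : (σ →₀ ℕ) →+ (τ →₀ ℕ)}
  {Φ : MvPolynomial σ K →ₐ[K] MvPolynomial τ K}

theorem coeff_eq_sum_fiber (hΦ : ∀ e c, Φ (monomial e c) = monomial (φ e) c) [DecidableEq (τ →₀ ℕ)]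
    (f : MvPolynomial σ K) (d : τ →₀ ℕ) :
    coeff d (Φ f) = ∑ e ∈ f.support with φ e = d, coeff e f := by
  conv_lhs => rw [← support_sum_monomial_coeff f]
  rw [map_sum, coeff_sum, Finset.sum_filter]
  exact Finset.sum_congr rfl fun e _ => by
    classical
    rw [hΦ, coeff_monomial]
    split_ifs <;> rfl

/-- Another quadratic monomial in the fiber of `x_s x_t` has larger weight. -/
def IsImprovable (φ : (σ →₀ ℕ) →+ (τ →₀ ℕ)) (w : σ → ℕ) (s t : σ) : Prop :=
  ∃ s' t', φ (Finsupp.single s' 1 + Finsupp.single t' 1) =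
    φ (Finsupp.single s 1 + Finsupp.single t 1) ∧ w s + w t < w s' + w t'

/-- No monomial `x_s x_t` with `x_s x_t` improvable divides the monomial with exponent `e`. -/
def IsStandard (φ : (σ →₀ ℕ) →+ (τ →₀ ℕ)) (w : σ → ℕ) (e : σ →₀ ℕ) : Prop :=
  ∀ s t, e s ≠ 0 → e t ≠ 0 → ¬ IsImprovable φ w s t

/-- Every fiber of `φ` contains at most one standard monomial, and squares of variables are not
improvable. The latter makes the leading terms of the quadratic binomials squarefree. -/
structure IsGroebnerWeight (φ : (σ →₀ ℕ) →+ (τ →₀ ℕ)) (w : σ → ℕ) : Prop where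
  ne_of_isImprovable : ∀ s t, IsImprovable φ w s t → s ≠ t
  eq_of_isStandard : ∀ e e', IsStandard φ w e → IsStandard φ w e' → φ e = φ e' → e = e'

/-- The quadratic binomials in the kernel of the toric map with exponent map `φ`. -/
def quadraticBinomials (φ : (σ →₀ ℕ) →+ (τ →₀ ℕ)) (K : Type v) [Field K] :
    Set (MvPolynomial σ K) :=
  {f | ∃ a b : σ →₀ ℕ, a ≠ b ∧ a.degree = 2 ∧ b.degree = 2 ∧ φ a = φ b ∧
    f = monomial a 1 - monomial b 1}

theorem single_add_single_le {e : σ →₀ ℕ} {s t : σ} (hst : s ≠ t) (hs : e s ≠ 0) (ht : e t ≠ 0) :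
    Finsupp.single s 1 + Finsupp.single t 1 ≤ e := by
  classical
  intro x
  simp only [Finsupp.add_apply, Finsupp.single_apply]
  split_ifs with h1 h2 h2
  · exact absurd (h1.trans h2.symm) hst
  · subst h1; omega
  · subst h2; omega
  · omega

/-- The total cost of a monomial; maximizing the weight of quadratic monomials in a fiber is the
same as minimizing the cost. -/
def totalCost (w : σ → ℕ) (N : ℕ) : (σ →₀ ℕ) →+ ℕ :=
  Finsupp.liftAddHom fun s => multiplesHom ℕ (N - w s)

theorem totalCost_single_add_single (w : σ → ℕ) (N : ℕ) (s t : σ) :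
    totalCost w N (Finsupp.single s 1 + Finsupp.single t 1) = (N - w s) + (N - w t) := by
  simp [totalCost]

/-- Improving pairs of variables terminates in a standard monomial. -/
theorem IsGroebnerWeight.exists_isStandard {w : σ → ℕ} (h : IsGroebnerWeight φ w) {N : ℕ}
    (hN : ∀ s, w s ≤ N) (e : σ →₀ ℕ) :
    ∃ e', IsStandard φ w e' ∧ φ e' = φ e ∧ (e' = e ∨ totalCost w N e' < totalCost w N e) ∧
      monomial e (1 : K) - monomial e' 1 ∈ Ideal.span (quadraticBinomials φ K) := by
  induction hn : totalCost w N e using Nat.strong_induction_on generalizing e with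
  | _ n ih =>
    by_cases he : IsStandard φ w e
    · exact ⟨e, he, rfl, Or.inl rfl, by simp⟩
    · simp only [IsStandard, not_forall, not_not] at he
      obtain ⟨s, t, hs, ht, himp⟩ := he
      have hst := h.ne_of_isImprovable s t himp
      obtain ⟨s', t', hφ, hw⟩ := himp
      obtain ⟨c, rfl⟩ := exists_add_of_le (single_add_single_le hst hs ht)
      generalize ha : Finsupp.single s 1 + Finsupp.single t 1 = a at *
      generalize hb : Finsupp.single s' 1 + Finsupp.single t' 1 = b at *
      have hab : totalCost w N b < totalCost w N a := by
        rw [← ha, ← hb, totalCost_single_add_single, totalCost_single_add_single]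
        have := hN s; have := hN t; have := hN s'; have := hN t'
        omega
      have hlt : totalCost w N (b + c) < n := by
        rw [← hn, map_add, map_add]
        omega
      obtain ⟨e', he', hφ', hcost, hmem⟩ := ih _ hlt (b + c) rfl
      refine ⟨e', he', ?_, Or.inr ?_, ?_⟩
      · rw [hφ', map_add, map_add, hφ]
      · rcases hcost with rfl | hcost <;> omega
      · have hq : monomial a (1 : K) - monomial b 1 ∈ Ideal.span (quadraticBinomials φ K) :=
          Ideal.subset_span ⟨a, b, fun e => by rw [e] at hab; omega, by simp [← ha], by simp [← hb],
            hφ.symm, rfl⟩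
        have hmul := Ideal.mul_mem_left _ (monomial c (1 : K)) hq
        rw [mul_sub, monomial_mul, monomial_mul, one_mul, add_comm c, add_comm c] at hmul
        simpa using add_mem hmul hmem

theorem quadraticBinomials_subset_ker (hΦ : ∀ e c, Φ (monomial e c) = monomial (φ e) c) :
    Ideal.span (quadraticBinomials φ K) ≤ RingHom.ker Φ := by
  rw [Ideal.span_le]
  rintro _ ⟨a, b, -, -, -, hab, rfl⟩
  rw [SetLike.mem_coe, RingHom.mem_ker, map_sub, hΦ, hΦ, hab, sub_self]

/-- Replacing every monomial by the standard one in its fiber changes a polynomial by an element of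
the quadratic part of the ideal, and turns a polynomial of the kernel into zero. -/
theorem IsGroebnerWeight.ker_eq_span [Finite σ] {w : σ → ℕ} (h : IsGroebnerWeight φ w)
    (hΦ : ∀ e c, Φ (monomial e c) = monomial (φ e) c) :
    RingHom.ker Φ = Ideal.span (quadraticBinomials φ K) := by
  classical
  refine le_antisymm (fun f hf => ?_) (quadraticBinomials_subset_ker hΦ)
  have := Fintype.ofFinite σ
  have hN : ∀ s, w s ≤ Finset.univ.sup w := fun s => Finset.le_sup (Finset.mem_univ s)
  choose nf hnf hφ _ hmem using h.exists_isStandard (K := K) hN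
  have hfac : ∀ e e', φ e = φ e' → nf e = nf e' := fun e e' he =>
    h.eq_of_isStandard _ _ (hnf e) (hnf e') (by rw [hφ, hφ, he])
  have hzero : ∑ e ∈ f.support, monomial (nf e) (coeff e f) = 0 := by
    rw [← Finset.sum_fiberwise_of_maps_to (t := f.support.image φ)
      (fun e he => Finset.mem_image_of_mem φ he)]
    refine Finset.sum_eq_zero fun d hd => ?_
    obtain ⟨e₀, -, rfl⟩ := Finset.mem_image.1 hd
    rw [Finset.sum_congr rfl (g := fun e => monomial (nf e₀) (coeff e f))
      (fun e he => by rw [hfac e e₀ (Finset.mem_filter.1 he).2]), ← map_sum,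
      ← coeff_eq_sum_fiber hΦ, (RingHom.mem_ker).1 hf, coeff_zero, map_zero]
  have hdiff : f = ∑ e ∈ f.support, C (coeff e f) * (monomial e 1 - monomial (nf e) 1) := by
    simp only [mul_sub, C_mul_monomial, mul_one, Finset.sum_sub_distrib, hzero, sub_zero]
    exact (support_sum_monomial_coeff f).symm
  rw [hdiff]
  exact Ideal.sum_mem _ fun e _ => Ideal.mul_mem_left _ _ (hmem e)

theorem IsGroebnerWeight.generatedByQuadraticBinomials [Finite σ] {w : σ → ℕ}
    (h : IsGroebnerWeight φ w) (hΦ : ∀ e c, Φ (monomial e c) = monomial (φ e) c) :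
    GeneratedByQuadraticBinomials (RingHom.ker Φ) :=
  ⟨quadraticBinomials φ K, fun _ ⟨a, b, hab, ha, hb, _, hf⟩ => ⟨a, b, hab, ha, hb, hf⟩,
    h.ker_eq_span hΦ⟩

/-- For a monomial order that refines the cost, a leading monomial of the kernel is not standard:
its fiber contains a smaller monomial of the same polynomial, hence a smaller standard monomial. -/
theorem IsGroebnerWeight.exists_initialIdeal [Finite σ] {w : σ → ℕ} (h : IsGroebnerWeight φ w)
    (hΦ : ∀ e c, Φ (monomial e c) = monomial (φ e) c) :
    ∃ m : MonomialOrder.{u, u} σ,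
      GeneratedBySquarefreeQuadraticMonomials (initialIdeal m (RingHom.ker Φ)) := by
  classical
  have := Fintype.ofFinite σ
  have hN : ∀ s, w s ≤ Finset.univ.sup w := fun s => Finset.le_sup (Finset.mem_univ s)
  obtain ⟨m, hm⟩ := exists_monomialOrder_of_weight (totalCost w (Finset.univ.sup w))
  refine ⟨m, {a | ∃ s t, IsImprovable φ w s t ∧ a = Finsupp.single s 1 + Finsupp.single t 1},
    ?_, le_antisymm ?_ ?_⟩
  · rintro _ ⟨s, t, hst, rfl⟩
    have hne := h.ne_of_isImprovable s t hst
    refine ⟨by simp, fun x => ?_⟩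
    simp only [Finsupp.add_apply, Finsupp.single_apply]
    split_ifs with h1 h2
    · exact absurd (h1.trans h2.symm) hne
    all_goals omega
  · refine Ideal.span_le.2 ?_
    rintro _ ⟨f, hf, hf0, rfl⟩
    obtain ⟨d, hd⟩ : ∃ d, d = m.degree f := ⟨_, rfl⟩
    rw [← hd]
    have hnot : ¬ IsStandard φ w d := by
      intro hstd
      have hc : coeff d f ≠ 0 := hd ▸ MonomialOrder.coeff_degree_ne_zero_iff.2 hf0
      have hsum := coeff_eq_sum_fiber hΦ f (φ d)
      rw [(RingHom.mem_ker).1 hf, coeff_zero] at hsum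
      obtain ⟨e, he, hed⟩ : ∃ e ∈ f.support.filter (fun e => φ e = φ d), e ≠ d := by
        by_contra! hcon
        have hdm : d ∈ f.support.filter (fun e => φ e = φ d) :=
          Finset.mem_filter.2 ⟨mem_support_iff.2 hc, rfl⟩
        rw [Finset.sum_eq_single_of_mem d hdm
          (fun e he hne => absurd (hcon e he) hne)] at hsum
        exact hc hsum.symm
      rw [Finset.mem_filter] at he
      obtain ⟨e', he', hφ, hcost, -⟩ := h.exists_isStandard (K := K) hN e
      obtain rfl := h.eq_of_isStandard _ _ he' hstd (hφ.trans he.2)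
      rcases hcost with hcost | hcost
      · exact hed hcost.symm
      · exact absurd (hm _ _ hcost) (not_lt.2 (hd ▸ MonomialOrder.le_degree he.1))
    simp only [IsStandard, not_forall, not_not] at hnot
    obtain ⟨s, t, hs, ht, himp⟩ := hnot
    obtain ⟨c, hc⟩ := exists_add_of_le
      (single_add_single_le (h.ne_of_isImprovable s t himp) hs ht)
    have := Ideal.mul_mem_left (Ideal.span ((fun a => monomial a (1 : K)) ''
      {a | ∃ s t, IsImprovable φ w s t ∧ a = Finsupp.single s 1 + Finsupp.single t 1}))
      (monomial c 1) (Ideal.subset_span ⟨_, ⟨s, t, himp, rfl⟩, rfl⟩)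
    simp only [monomial_mul, mul_one] at this
    rwa [add_comm c, ← hc] at this
  · refine Ideal.span_le.2 ?_
    rintro _ ⟨_, ⟨s, t, ⟨s', t', hφ, hw⟩, rfl⟩, rfl⟩
    set a : σ →₀ ℕ := Finsupp.single s 1 + Finsupp.single t 1 with ha
    set b : σ →₀ ℕ := Finsupp.single s' 1 + Finsupp.single t' 1 with hb
    have hlt : m.toSyn b < m.toSyn a := by
      apply hm
      rw [ha, hb, totalCost_single_add_single, totalCost_single_add_single]
      have := hN s; have := hN t; have := hN s'; have := hN t'
      omega
    have hdeg : m.degree (monomial a (1 : K) - monomial b 1) = a := by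
      rw [MonomialOrder.degree_sub_of_lt] <;> simp [MonomialOrder.degree_monomial, hlt]
    refine Ideal.subset_span ⟨monomial a 1 - monomial b 1, ?_, ?_, by rw [hdeg]⟩
    · rw [RingHom.mem_ker, map_sub, hΦ, hΦ, hφ, sub_self]
    · intro h0
      have hne : b ≠ a := fun e => by rw [e] at hlt; exact lt_irrefl _ hlt
      have := congrArg (coeff a) h0
      simp [coeff_monomial, hne] at this

end Groebner

/-! ### The toric ideal of the stable set polytope -/

section StableSet

variable {V : Type u} {G : SimpleGraph V}

/-- The exponent of the monomial `s * ∏ v ∈ S, t_v`. -/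
def stableExponent (S : StableSet G) : Option V →₀ ℕ :=
  ∑ v ∈ S.1, Finsupp.single (some v) 1 + Finsupp.single none 1

/-- The exponent map of `toricMap`. -/
def toricExponent (G : SimpleGraph V) : (StableSet G →₀ ℕ) →+ (Option V →₀ ℕ) :=
  Finsupp.liftAddHom fun S => multiplesHom _ (stableExponent S)

theorem toricExponent_single (S : StableSet G) (n : ℕ) :
    toricExponent G (Finsupp.single S n) = n • stableExponent S := by
  simp [toricExponent]

theorem toricMap_monomial (K : Type v) [Field K] (e : StableSet G →₀ ℕ) (c : K) :
    toricMap G K (MvPolynomial.monomial e c) = MvPolynomial.monomial (toricExponent G e) c := by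
  have hX : ∀ S : StableSet G, (∏ v ∈ S.1, (MvPolynomial.X (some v) : MvPolynomial (Option V) K)) *
      MvPolynomial.X none = MvPolynomial.monomial (stableExponent S) 1 := by
    intro S
    simp only [MvPolynomial.X, stableExponent]
    rw [← MvPolynomial.monomial_sum_one, MvPolynomial.monomial_mul, one_mul]
  rw [toricMap, MvPolynomial.aeval_monomial]
  simp only [hX, MvPolynomial.monomial_pow, one_pow]
  rw [Finsupp.prod, ← MvPolynomial.monomial_sum_one, MvPolynomial.algebraMap_eq,
    MvPolynomial.C_mul_monomial, mul_one, toricExponent, Finsupp.liftAddHom_apply]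
  rfl

theorem stableExponent_none (S : StableSet G) : stableExponent S none = 1 := by
  simp [stableExponent]

theorem stableExponent_some [DecidableEq V] (S : StableSet G) (v : V) :
    stableExponent S (some v) = S.1.val.count v := by
  simp [stableExponent, Finsupp.single_apply,
    Multiset.count_eq_of_nodup S.1.nodup]

/-- The family of stable sets that corresponds to a monomial. -/
def family (e : StableSet G →₀ ℕ) : Multiset (Finset V) := e.toMultiset.map Subtype.val

theorem toricExponent_none (e : StableSet G →₀ ℕ) : toricExponent G e none = (family e).card := by
  induction e using Finsupp.induction_linear with
  | zero => simp [family]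
  | add e f he hf => simpa [family] using congrArg₂ (· + ·) he hf
  | single S n => simp [toricExponent_single, stableExponent_none, family]

theorem toricExponent_some [DecidableEq V] (e : StableSet G →₀ ℕ) (v : V) :
    toricExponent G e (some v) = ((family e).map Finset.val).sum.count v := by
  induction e using Finsupp.induction_linear with
  | zero => simp [family]
  | add e f he hf =>
    simp only [family, map_add, Finsupp.add_apply, Multiset.map_add, Multiset.sum_add,
      Multiset.count_add] at he hf ⊢
    rw [he, hf]
  | single S n =>
    simp [toricExponent_single, stableExponent_some, family, Multiset.map_nsmul, Multiset.sum_nsmul,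
      Multiset.count_nsmul]

theorem toricExponent_eq_iff {e e' : StableSet G →₀ ℕ} :
    toricExponent G e = toricExponent G e' ↔ (family e).card = (family e').card ∧
      ((family e).map Finset.val).sum = ((family e').map Finset.val).sum := by
  classical
  rw [Finsupp.ext_iff, Option.forall, toricExponent_none, toricExponent_none, Multiset.ext]
  simp only [toricExponent_some]

theorem toricExponent_pair_eq_iff {S T S' T' : StableSet G} :
    toricExponent G (Finsupp.single S' 1 + Finsupp.single T' 1) =
      toricExponent G (Finsupp.single S 1 + Finsupp.single T 1) ↔
      S'.1.val + T'.1.val = S.1.val + T.1.val := by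
  rw [toricExponent_eq_iff]
  simp [family]

/-- A monomial in the variables `x_S` is a family of stable sets, and standard monomials are the
families all of whose pairs are maximal. -/
theorem IsQuadraticWeight.isGroebnerWeight {w : Finset V → ℕ}
    (hw : IsQuadraticWeight G Set.univ w) :
    IsGroebnerWeight (toricExponent G) (fun S : StableSet G => w S.1) := by
  constructor
  · rintro S _ ⟨S', T', heq, hlt⟩ rfl
    have h := val_add_val_eq_iff.1 (toricExponent_pair_eq_iff.1 heq)
    have h1 : S'.1 = S.1 := Finset.ext fun v => by have := h v; tauto
    have h2 : T'.1 = S.1 := Finset.ext fun v => by have := h v; tauto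
    simp [h1, h2] at hlt
  · intro e e' he he' heq
    obtain ⟨hc, hs⟩ := toricExponent_eq_iff.1 heq
    have hst : ∀ a : StableSet G →₀ ℕ, ∀ S ∈ family a, IsStableIn G Set.univ S := by
      intro a S hS
      obtain ⟨S, -, rfl⟩ := Multiset.mem_map.1 hS
      exact ⟨Set.subset_univ _, S.2⟩
    have hmax : ∀ a : StableSet G →₀ ℕ,
        IsStandard (toricExponent G) (fun S : StableSet G => w S.1) a →
        ∀ S ∈ family a, ∀ T ∈ family a, IsMaximalPair G Set.univ w S T := by
      intro a ha S hS T hT S' T' hS' hT' hsum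
      obtain ⟨S, hSa, rfl⟩ := Multiset.mem_map.1 hS
      obtain ⟨T, hTa, rfl⟩ := Multiset.mem_map.1 hT
      rw [Finsupp.mem_toMultiset, Finsupp.mem_support_iff] at hSa hTa
      by_contra! hlt
      exact ha S T hSa hTa ⟨⟨S', hS'.2⟩, ⟨T', hT'.2⟩, toricExponent_pair_eq_iff.2 hsum, hlt⟩
    have := hw _ _ (hst e) (hst e') (hmax e he) (hmax e' he') hc hs
    have hms := Multiset.map_injective Subtype.val_injective this
    classical
    ext S
    rw [← Finsupp.count_toMultiset, hms, Finsupp.count_toMultiset]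

end StableSet

/-! ### Even antiholes obstruct quadratic generation -/

section EvenAntihole

variable {V : Type u} {G : SimpleGraph V}

theorem add_one_mod_eq_or {n : ℕ} (hn : 0 < n) (k : ℕ) :
    (k + 1) % n = k % n + 1 ∨ ((k + 1) % n = 0 ∧ k % n + 1 = n) := by
  rw [← Nat.mod_add_mod]
  have := Nat.mod_lt k hn
  rcases Nat.lt_or_ge (k % n + 1) n with h | h
  · exact Or.inl (Nat.mod_eq_of_lt h)
  · have h' : k % n + 1 = n := by omega
    rw [h', Nat.mod_self]
    exact Or.inr ⟨rfl, rfl⟩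

/-- In an even antihole of length at least six, two disjoint pairs of cyclically consecutive
vertices that start at even positions cannot be exchanged for another pair of stable sets: a stable
set contains no two of the four vertices at distinct positions of equal parity, and the two pairs
are not consecutive on both sides. -/
theorem pair_eq_of_val_add_val_eq [DecidableEq V] {F : ℕ → V} {n : ℕ} (hn : 6 ≤ n)
    (heven : n % 2 = 0) (hinj : ∀ k l, k < n → l < n → F k = F l → k = l)
    (hF : ∀ k l, k < n → l < n → k ≠ l → ¬ G.Adj (F k) (F l) →
      k + 1 = l ∨ l + 1 = k ∨ (k = 0 ∧ l + 1 = n) ∨ (l = 0 ∧ k + 1 = n))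
    {p q : ℕ} (hp : p % 2 = 0) (hq : q % 2 = 0) (hpn : p + 1 < n) (hqn : q + 1 < n) (hpq : p ≠ q)
    {S T : Finset V} (hS : G.IsIndepSet (S : Set V)) (hT : G.IsIndepSet (T : Set V))
    (h : S.val + T.val = ({F p, F (p + 1)} : Finset V).val + ({F q, F (q + 1)} : Finset V).val) :
    (S = {F p, F (p + 1)} ∧ T = {F q, F (q + 1)}) ∨
      (S = {F q, F (q + 1)} ∧ T = {F p, F (p + 1)}) := by
  have main : ∀ {A B : Finset V}, G.IsIndepSet (A : Set V) → G.IsIndepSet (B : Set V) →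
      A.val + B.val = ({F p, F (p + 1)} : Finset V).val + ({F q, F (q + 1)} : Finset V).val →
      F p ∈ A → A = {F p, F (p + 1)} ∧ B = {F q, F (q + 1)} := by
    intro A B hA hB hAB hpA
    rw [val_add_val_eq_iff] at hAB
    simp only [Finset.mem_insert, Finset.mem_singleton] at hAB
    have hne : ∀ k l, k < n → l < n → k ≠ l → F k ≠ F l := fun k l hk hl hkl e =>
      hkl (hinj k l hk hl e)
    have n1 := hne p (p + 1) (by omega) hpn (by omega)
    have n2 := hne p q (by omega) (by omega) hpq
    have n3 := hne p (q + 1) (by omega) hqn (by omega)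
    have n4 := hne (p + 1) q hpn (by omega) (by omega)
    have n5 := hne (p + 1) (q + 1) hpn hqn (by omega)
    have n6 := hne q (q + 1) (by omega) hqn (by omega)
    have cyc : ∀ {D : Finset V}, G.IsIndepSet (D : Set V) → ∀ k l, k < n → l < n → k ≠ l →
        F k ∈ D → F l ∈ D →
        k + 1 = l ∨ l + 1 = k ∨ (k = 0 ∧ l + 1 = n) ∨ (l = 0 ∧ k + 1 = n) :=
      fun hD k l hk hl hkl hkD hlD => hF k l hk hl hkl (hD hkD hlD (hne k l hk hl hkl))
    have hqA : F q ∉ A := fun hqA => by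
      have := cyc hA p q (by omega) (by omega) hpq hpA hqA
      omega
    have hqB : F q ∈ B := ((hAB (F q)).1.2 (Or.inr (Or.inl rfl))).resolve_left hqA
    have hpB : F p ∉ B := fun hpB => by
      have := (hAB (F p)).2.1 ⟨hpA, hpB⟩
      tauto
    by_cases hp1 : F (p + 1) ∈ A
    · have hq1A : F (q + 1) ∉ A := fun hq1A => by
        have := cyc hA (p + 1) (q + 1) hpn hqn (by omega) hp1 hq1A
        omega
      have hq1B : F (q + 1) ∈ B := ((hAB (F (q + 1))).1.2 (Or.inr (Or.inr rfl))).resolve_left hq1A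
      have hp1B : F (p + 1) ∉ B := fun hp1B => by
        have := (hAB (F (p + 1))).2.1 ⟨hp1, hp1B⟩
        tauto
      constructor
      · ext v
        simp only [Finset.mem_insert, Finset.mem_singleton]
        refine ⟨fun hv => ?_, fun hv => by rcases hv with rfl | rfl <;> assumption⟩
        rcases (hAB v).1.1 (Or.inl hv) with h | rfl | rfl
        · exact h
        · exact absurd hv hqA
        · exact absurd hv hq1A
      · ext v
        simp only [Finset.mem_insert, Finset.mem_singleton]
        refine ⟨fun hv => ?_, fun hv => by rcases hv with rfl | rfl <;> assumption⟩
        rcases (hAB v).1.1 (Or.inr hv) with (rfl | rfl) | h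
        · exact absurd hv hpB
        · exact absurd hv hp1B
        · exact h
    · have hp1B : F (p + 1) ∈ B := ((hAB (F (p + 1))).1.2 (Or.inl (Or.inr rfl))).resolve_left hp1
      have h1 := cyc hB (p + 1) q hpn (by omega) (by omega) hp1B hqB
      have hq1B : F (q + 1) ∉ B := fun hq1B => by
        have := cyc hB (p + 1) (q + 1) hpn hqn (by omega) hp1B hq1B
        omega
      have hq1A : F (q + 1) ∈ A := ((hAB (F (q + 1))).1.2 (Or.inr (Or.inr rfl))).resolve_right hq1B
      have h2 := cyc hA p (q + 1) (by omega) hqn (by omega) hpA hq1A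
      omega
  rcases (val_add_val_eq_iff.1 h (F p)).1.2 (Or.inl (by simp)) with hpS | hpT
  · exact Or.inl (main hS hT h hpS)
  · exact Or.inr (main hT hS ((add_comm _ _).trans h) hpT).symm

theorem exists_single_add_single {σ : Type*} {a : σ →₀ ℕ} (ha : a.degree = 2) :
    ∃ s t, a = Finsupp.single s 1 + Finsupp.single t 1 := by
  classical
  obtain ⟨s, t, hst⟩ := Multiset.card_eq_two.1 ((Finsupp.card_toMultiset a).trans ha)
  refine ⟨s, t, ?_⟩
  ext x
  rw [← Finsupp.count_toMultiset, ← Finsupp.count_toMultiset, hst]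
  simp [Multiset.insert_eq_cons]

/-- If no monomial of the binomials in `B` divides the monomial with exponent `E`, then the latter
does not occur in any element of the ideal generated by `B`. -/
theorem coeff_eq_zero_of_mem_span {σ : Type*} {K : Type*} [Field K] {B : Set (MvPolynomial σ K)}
    {E : σ →₀ ℕ}
    (hB : ∀ f ∈ B, ∃ a b : σ →₀ ℕ, ¬ a ≤ E ∧ ¬ b ≤ E ∧
      f = MvPolynomial.monomial a 1 - MvPolynomial.monomial b 1)
    {f : MvPolynomial σ K} (hf : f ∈ Ideal.span B) : MvPolynomial.coeff E f = 0 := by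
  have key : ∀ g, MvPolynomial.coeff E (g * f) = 0 := by
    refine Submodule.span_induction (p := fun f _ => ∀ g, MvPolynomial.coeff E (g * f) = 0)
      ?_ ?_ ?_ ?_ hf
    · intro f hfB g
      obtain ⟨a, b, ha, hb, rfl⟩ := hB f hfB
      rw [mul_sub, MvPolynomial.coeff_sub, MvPolynomial.coeff_mul_monomial',
        MvPolynomial.coeff_mul_monomial', if_neg ha, if_neg hb, sub_zero]
    · simp
    · intro x y _ _ hx hy g
      rw [mul_add, MvPolynomial.coeff_add, hx, hy, add_zero]
    · intro c x _ hx g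
      rw [smul_eq_mul, ← mul_assoc]
      exact hx _
  simpa using key 1

/-- The two perfect matchings of an even cycle of length `2 * m ≥ 6` give a binomial of degree `m`
that is not in the ideal generated by the quadratic binomials of the toric ideal. -/
theorem not_isIndContained_of_generatedByQuadraticBinomials {K : Type v} [Field K]
    (hgen : GeneratedByQuadraticBinomials (toricIdeal G K)) {m : ℕ} (hm : 3 ≤ m) :
    ¬ (SimpleGraph.cycleGraph (2 * m))ᶜ ⊴ G := by
  classical
  rintro ⟨f⟩
  obtain ⟨n, hn⟩ : ∃ n, n = 2 * m := ⟨_, rfl⟩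
  rw [← hn] at f
  have hn0 : 0 < n := by omega
  let F : ℕ → V := fun k => f ⟨k % n, Nat.mod_lt _ hn0⟩
  have hFmod : ∀ k l, k < n → l < n → F k = F l → k = l := by
    intro k l hk hl e
    have := congrArg Fin.val (f.injective e)
    simpa only [Nat.mod_eq_of_lt hk, Nat.mod_eq_of_lt hl] using this
  have hFadj : ∀ k l, G.Adj (F k) (F l) ↔ k % n ≠ l % n ∧
      ¬ (k % n + 1 = l % n ∨ l % n + 1 = k % n ∨ (k % n = 0 ∧ l % n + 1 = n) ∨
        (l % n = 0 ∧ k % n + 1 = n)) := by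
    intro k l
    simp only [F, SimpleGraph.Embedding.map_adj_iff, SimpleGraph.compl_adj,
      cycleGraph_adj_iff_val (show 3 ≤ n by omega), ne_eq, Fin.mk.injEq]
  have hsucc := add_one_mod_eq_or hn0
  have hFne : ∀ k, F k ≠ F (k + 1) := by
    intro k e
    have h1 := congrArg Fin.val (f.injective e)
    have h2 := hsucc k
    simp only at h1
    omega
  have hFnon : ∀ k, ¬ G.Adj (F k) (F (k + 1)) := by
    intro k h
    have h1 := (hFadj k (k + 1)).1 h
    have h2 := hsucc k
    omega
  have hFnn : F n = F 0 := by simp [F]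
  have hstab : ∀ k, G.IsIndepSet (({F k, F (k + 1)} : Finset V) : Set V) := by
    intro k x hx y hy hxy hadj
    simp only [Finset.coe_insert, Finset.coe_singleton, Set.mem_insert_iff,
      Set.mem_singleton_iff] at hx hy
    rcases hx with rfl | rfl <;> rcases hy with rfl | rfl
    · exact hxy rfl
    · exact hFnon k hadj
    · exact hFnon k hadj.symm
    · exact hxy rfl
  let edge : ℕ → StableSet G := fun k => ⟨{F k, F (k + 1)}, hstab k⟩
  let E : StableSet G →₀ ℕ := ∑ i ∈ Finset.range m, Finsupp.single (edge (2 * i)) 1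
  let O : StableSet G →₀ ℕ := ∑ i ∈ Finset.range m, Finsupp.single (edge (2 * i + 1)) 1
  have hexp : toricExponent G E = toricExponent G O := by
    have hedge : ∀ k, toricExponent G (Finsupp.single (edge k) 1) =
        Finsupp.single (some (F k)) 1 + Finsupp.single (some (F (k + 1))) 1 +
          Finsupp.single none 1 := by
      intro k
      rw [toricExponent_single, one_smul, stableExponent, Finset.sum_pair (hFne k)]
    have h1 := Finset.sum_range_succ
      (fun i => (Finsupp.single (some (F (2 * i))) 1 : Option V →₀ ℕ)) m
    have h2 := Finset.sum_range_succ'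
      (fun i => (Finsupp.single (some (F (2 * i))) 1 : Option V →₀ ℕ)) m
    rw [h1, ← hn, hFnn, mul_zero] at h2
    have h3 := add_right_cancel h2
    simp only [E, O, map_sum, hedge, Finset.sum_add_distrib]
    rw [h3]
    congr 1
    rw [add_comm]
    rfl
  have hcases : ∀ i j, i < m → j < m → edge (2 * i) = edge (2 * j) → i = j := by
    intro i j hi hj e
    have hval : ({F (2 * i), F (2 * i + 1)} : Finset V) = {F (2 * j), F (2 * j + 1)} :=
      congrArg Subtype.val e
    have hmem : F (2 * i) ∈ ({F (2 * j), F (2 * j + 1)} : Finset V) := by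
      rw [← hval]
      exact Finset.mem_insert_self _ _
    rcases Finset.mem_insert.1 hmem with h | h
    · have := hFmod _ _ (by omega) (by omega) h
      omega
    · have := hFmod _ _ (by omega) (by omega) (Finset.mem_singleton.1 h)
      omega
  have hEapply : ∀ s, E s = ((Finset.range m).filter fun i => edge (2 * i) = s).card := by
    intro s
    simp [E, Finsupp.single_apply]
  have hEle : ∀ s, E s ≤ 1 := by
    intro s
    rw [hEapply, Finset.card_le_one]
    intro i hi j hj
    simp only [Finset.mem_filter, Finset.mem_range] at hi hj
    exact hcases i j hi.1 hj.1 (hi.2.trans hj.2.symm)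
  have hEmem : ∀ s, E s ≠ 0 → ∃ i < m, s = edge (2 * i) := by
    intro s hs
    rw [hEapply, Finset.card_ne_zero] at hs
    obtain ⟨i, hi⟩ := hs
    simp only [Finset.mem_filter, Finset.mem_range] at hi
    exact ⟨i, hi.1, hi.2.symm⟩
  have key : ∀ a b : StableSet G →₀ ℕ, a ≤ E → a.degree = 2 → b.degree = 2 →
      toricExponent G b = toricExponent G a → b = a := by
    intro a b haE ha hb hab
    obtain ⟨s, t, rfl⟩ := exists_single_add_single ha
    obtain ⟨s', t', rfl⟩ := exists_single_add_single hb
    have hs := haE s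
    have ht := haE t
    have hs1 := hEle s
    simp only [Finsupp.add_apply, Finsupp.single_eq_same] at hs ht
    have hst : s ≠ t := by
      rintro rfl
      simp only [Finsupp.single_eq_same] at hs
      omega
    obtain ⟨i, hi, rfl⟩ := hEmem s (by omega)
    obtain ⟨j, hj, rfl⟩ := hEmem t (by omega)
    have hij : i ≠ j := fun e => hst (e ▸ rfl)
    rcases pair_eq_of_val_add_val_eq (G := G) (F := F) (n := n) (p := 2 * i) (q := 2 * j)
      (by omega) (by omega) hFmod (fun k l hk hl hkl hnadj => by
        have := (hFadj k l).not.1 hnadj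
        rw [Nat.mod_eq_of_lt hk, Nat.mod_eq_of_lt hl] at this
        omega) (by omega) (by omega) (by omega) (by omega) (by omega) s'.2 t'.2
      (toricExponent_pair_eq_iff.1 hab) with ⟨h1, h2⟩ | ⟨h1, h2⟩
    · rw [show s' = edge (2 * i) from Subtype.ext h1, show t' = edge (2 * j) from Subtype.ext h2]
    · rw [show s' = edge (2 * j) from Subtype.ext h1, show t' = edge (2 * i) from Subtype.ext h2,
        add_comm]
  obtain ⟨B, hB, hspan⟩ := hgen
  have hmem : MvPolynomial.monomial E (1 : K) - MvPolynomial.monomial O 1 ∈ Ideal.span B := by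
    rw [← hspan, toricIdeal, RingHom.mem_ker, map_sub, toricMap_monomial, toricMap_monomial, hexp,
      sub_self]
  have hzero := coeff_eq_zero_of_mem_span (E := E) (fun g hg => by
    obtain ⟨a, b, hab, ha, hb, rfl⟩ := hB g hg
    have hker : MvPolynomial.monomial a (1 : K) - MvPolynomial.monomial b 1 ∈ toricIdeal G K :=
      hspan ▸ Ideal.subset_span hg
    rw [toricIdeal, RingHom.mem_ker, map_sub, toricMap_monomial, toricMap_monomial,
      sub_eq_zero, MvPolynomial.monomial_eq_monomial_iff] at hker
    have hexp' : toricExponent G a = toricExponent G b := by simpa using hker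
    exact ⟨a, b, fun h => hab (key a b h ha hb hexp'.symm).symm,
      fun h => hab (key b a h hb ha hexp'), rfl⟩) hmem
  have hOE : O ≠ E := by
    intro e
    have h1 : O (edge 1) ≠ 0 := by
      have : O (edge 1) = ((Finset.range m).filter fun i => edge (2 * i + 1) = edge 1).card := by
        simp [O, Finsupp.single_apply]
      rw [this, Finset.card_ne_zero]
      exact ⟨0, by simp; omega⟩
    rw [e] at h1
    obtain ⟨i, hi, hi'⟩ := hEmem _ h1
    have hval : ({F 1, F 2} : Finset V) = {F (2 * i), F (2 * i + 1)} := congrArg Subtype.val hi'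
    have h2 : F 1 ∈ ({F (2 * i), F (2 * i + 1)} : Finset V) := by
      rw [← hval]
      exact Finset.mem_insert_self _ _
    have h3 : F 2 ∈ ({F (2 * i), F (2 * i + 1)} : Finset V) := by
      rw [← hval]
      exact Finset.mem_insert_of_mem (Finset.mem_singleton_self _)
    simp only [Finset.mem_insert, Finset.mem_singleton] at h2 h3
    have g1 : 1 = 2 * i ∨ 1 = 2 * i + 1 :=
      h2.imp (hFmod _ _ (by omega) (by omega)) (hFmod _ _ (by omega) (by omega))
    have g2 : 2 = 2 * i ∨ 2 = 2 * i + 1 :=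
      h3.imp (hFmod _ _ (by omega) (by omega)) (hFmod _ _ (by omega) (by omega))
    omega
  rw [MvPolynomial.coeff_sub, MvPolynomial.coeff_monomial, MvPolynomial.coeff_monomial, if_pos rfl,
    if_neg hOE] at hzero
  simp at hzero

end EvenAntihole

/-! ### Holes, odd antiholes and stretchers in generalized split graphs -/

section Unipolar

variable {V : Type u} {G : SimpleGraph V}

/-- The vertices of an induced cycle of length `n ≥ 5`, listed in cyclic order: distances two and
three along such a cycle are not edges. -/
theorem exists_periodic_of_isIndContained {n : ℕ} (hn : 5 ≤ n)
    (h : SimpleGraph.cycleGraph n ⊴ G) :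
    ∃ F : ℕ → V, F n = F 0 ∧ (∀ k, G.Adj (F k) (F (k + 1))) ∧
      (∀ k, F k ≠ F (k + 2) ∧ ¬ G.Adj (F k) (F (k + 2))) ∧
      (∀ k, F k ≠ F (k + 3) ∧ ¬ G.Adj (F k) (F (k + 3))) := by
  obtain ⟨f⟩ := h
  have hn0 : 0 < n := by omega
  have hsucc := add_one_mod_eq_or hn0
  let F : ℕ → V := fun k => f ⟨k % n, Nat.mod_lt _ hn0⟩
  have hadj : ∀ k l, G.Adj (F k) (F l) ↔ k % n + 1 = l % n ∨ l % n + 1 = k % n ∨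
      (k % n = 0 ∧ l % n + 1 = n) ∨ (l % n = 0 ∧ k % n + 1 = n) := by
    intro k l
    simp only [F, SimpleGraph.Embedding.map_adj_iff, cycleGraph_adj_iff_val (show 3 ≤ n by omega)]
  have hne : ∀ k l, k % n ≠ l % n → F k ≠ F l := by
    intro k l hkl e
    exact hkl (congrArg Fin.val (f.injective e))
  refine ⟨F, by simp [F], fun k => ?_, fun k => ?_, fun k => ?_⟩
  · have := hsucc k
    rw [hadj]
    omega
  · have h1 := hsucc k
    have h2 : (k + 2) % n = (k + 1) % n + 1 ∨ ((k + 2) % n = 0 ∧ (k + 1) % n + 1 = n) :=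
      hsucc (k + 1)
    refine ⟨hne _ _ (by omega), ?_⟩
    rw [hadj]
    omega
  · have h1 := hsucc k
    have h2 : (k + 2) % n = (k + 1) % n + 1 ∨ ((k + 2) % n = 0 ∧ (k + 1) % n + 1 = n) :=
      hsucc (k + 1)
    have h3 : (k + 3) % n = (k + 2) % n + 1 ∨ ((k + 3) % n = 0 ∧ (k + 2) % n + 1 = n) :=
      hsucc (k + 2)
    refine ⟨hne _ _ (by omega), ?_⟩
    rw [hadj]
    omega

/-- Unipolar graphs have no holes: the core meets every three consecutive vertices of a hole, but
contains at most two vertices of it. -/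
theorem IsUnipolarCore.not_hole {C : Set V} (h : IsUnipolarCore G C) {n : ℕ} (hn : 5 ≤ n) :
    ¬ SimpleGraph.cycleGraph n ⊴ G := by
  intro hcyc
  obtain ⟨F, -, h1, h2, h3⟩ := exists_periodic_of_isIndContained hn hcyc
  have hmeet : ∀ k, F k ∈ C ∨ F (k + 1) ∈ C ∨ F (k + 2) ∈ C := by
    intro k
    by_contra! hcon
    exact (h2 k).2 (h.adj_of_adj _ _ _ hcon.1 hcon.2.1 hcon.2.2 (h1 k) (h1 (k + 1)) (h2 k).1)
  have hC2 : ∀ k, F k ∈ C → F (k + 2) ∉ C := fun k hk hk' => (h2 k).2 (h.isClique hk hk' (h2 k).1)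
  have hC3 : ∀ k, F k ∈ C → F (k + 3) ∉ C := fun k hk hk' => (h3 k).2 (h.isClique hk hk' (h3 k).1)
  obtain ⟨k, hk⟩ : ∃ k, F k ∈ C := by
    rcases hmeet 0 with h | h | h <;> exact ⟨_, h⟩
  have hk1 : F (k + 1) ∈ C := by
    rcases hmeet (k + 1) with h | h | h
    · exact h
    · exact absurd h (hC2 k hk)
    · exact absurd h (hC3 k hk)
  rcases hmeet (k + 2) with h | h | h
  · exact hC2 k hk h
  · exact hC3 k hk h
  · exact hC3 (k + 1) hk1 h

/-- If the complement is unipolar, there are no odd holes: no two consecutive vertices of a hole lie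
outside the core, nor inside it, so the hole alternates. -/
theorem IsUnipolarCore.not_oddHole_of_compl {C : Set V} (h : IsUnipolarCore Gᶜ C) {n : ℕ}
    (hn : 5 ≤ n) (hodd : Odd n) : ¬ SimpleGraph.cycleGraph n ⊴ G := by
  intro hcyc
  obtain ⟨F, h0, h1, h2, h3⟩ := exists_periodic_of_isIndContained hn hcyc
  have hC : ∀ k, F k ∈ C → F (k + 1) ∉ C := fun k hk hk' =>
    ((SimpleGraph.compl_adj _ _ _).1 (h.isClique hk hk' (h1 k).ne)).2 (h1 k)
  have hthree : ∀ k, F k ∉ C → F (k + 1) ∉ C → F (k + 3) ∈ C := by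
    intro k hk hk1
    by_contra hk3
    exact ((SimpleGraph.compl_adj _ _ _).1 (h.adj_of_adj (F k) (F (k + 3)) (F (k + 1)) hk hk3 hk1
      ((SimpleGraph.compl_adj _ _ _).2 (h3 k))
      ((SimpleGraph.compl_adj _ _ _).2 ⟨(h2 (k + 1)).1, (h2 (k + 1)).2⟩).symm (h1 k).ne)).2 (h1 k)
  have hout : ∀ k, F k ∉ C → F (k + 1) ∈ C := by
    intro k hk
    by_contra hk1
    have hk3 := hthree k hk hk1
    have hk2 : F (k + 2) ∉ C := fun hk2 => hC (k + 2) hk2 hk3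
    exact hC (k + 3) hk3 (hthree (k + 1) hk1 hk2)
  have halt : ∀ j, F (2 * j) ∈ C ↔ F 0 ∈ C := by
    intro j
    induction j with
    | zero => rfl
    | succ j ih =>
      rw [← ih]
      constructor
      · intro hj
        by_contra hj'
        exact hC (2 * j + 1) (hout (2 * j) hj') hj
      · exact fun hj => hout (2 * j + 1) (hC (2 * j) hj)
  obtain ⟨j, rfl⟩ := hodd
  have hj := halt j
  by_cases hF : F 0 ∈ C
  · exact hC (2 * j) (hj.2 hF) (h0 ▸ hF)
  · exact hF (h0 ▸ hout (2 * j) fun h => hF (hj.1 h))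

theorem isIndContained_compl_iff {α : Type*} {H : SimpleGraph α} : Hᶜ ⊴ G ↔ H ⊴ Gᶜ := by
  constructor
  · rintro ⟨f⟩
    have f' : Hᶜᶜ ↪g Gᶜ := SimpleGraph.Embedding.complEquiv f
    rw [compl_compl] at f'
    exact ⟨f'⟩
  · rintro ⟨f⟩
    have f' : Hᶜ ↪g Gᶜᶜ := SimpleGraph.Embedding.complEquiv f
    rw [compl_compl] at f'
    exact ⟨f'⟩

theorem IsGeneralizedSplit.noOddHoles (hG : IsGeneralizedSplit G) : NoOddHoles G := by
  intro n hn hodd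
  rcases hG with h | h
  · obtain ⟨C, hC⟩ := h.exists_isUnipolarCore
    exact hC.not_hole hn
  · obtain ⟨C, hC⟩ := h.exists_isUnipolarCore
    exact hC.not_oddHole_of_compl hn hodd

theorem IsGeneralizedSplit.compl (hG : IsGeneralizedSplit G) : IsGeneralizedSplit Gᶜ := by
  rcases hG with h | h
  · exact Or.inr (by rwa [compl_compl])
  · exact Or.inl h

theorem IsGeneralizedSplit.noAntiholes {K : Type v} [Field K] (hG : IsGeneralizedSplit G)
    (hgen : GeneratedByQuadraticBinomials (toricIdeal G K)) : NoAntiholes G := by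
  intro n hn hcyc
  rcases Nat.even_or_odd' n with ⟨m, rfl | rfl⟩
  · exact not_isIndContained_of_generatedByQuadraticBinomials hgen (by omega) hcyc
  · exact hG.compl.noOddHoles _ hn ⟨m, rfl⟩ (isIndContained_compl_iff.1 hcyc)

theorem IsUnipolarCore.comap {α : Type*} {H : SimpleGraph α} {C : Set V}
    (h : IsUnipolarCore G C) (f : H ↪g G) : IsUnipolarCore H (f ⁻¹' C) where
  isClique _ hx _ hy hxy := f.map_adj_iff.1 (h.isClique hx hy (f.injective.ne hxy))
  adj_of_adj _ _ _ ha hb hc hab hbc hac :=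
    f.map_adj_iff.1 (h.adj_of_adj _ _ _ ha hb hc (f.map_adj_iff.2 hab) (f.map_adj_iff.2 hbc)
      (f.injective.ne hac))

end Unipolar

section Stretcher

variable {l : Fin 3 → ℕ}

theorem oddStretcher_adj_iff {i j : Fin 3} {k k' : ℕ} (hk : k < 2 * l i) (hk' : k' < 2 * l j) :
    (oddStretcher l).Adj ⟨i, k, hk⟩ ⟨j, k', hk'⟩ ↔
      (i = j ∧ (k + 1 = k' ∨ k' + 1 = k)) ∨
        (i ≠ j ∧ ((k = 0 ∧ k' = 0) ∨ (k + 1 = 2 * l i ∧ k' + 1 = 2 * l j))) :=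
  Iff.rfl

theorem mk_ne_mk_of_ne {i j : Fin 3} {k k' : ℕ} (hk : k < 2 * l i) (hk' : k' < 2 * l j)
    (h : i ≠ j ∨ k ≠ k') :
    (⟨i, k, hk⟩ : Σ i : Fin 3, Fin (2 * l i)) ≠ ⟨j, k', hk'⟩ := by
  intro e
  obtain ⟨rfl, e⟩ := Sigma.mk.inj_iff.1 e
  rcases h with h | h
  · exact h rfl
  · exact h (congrArg Fin.val (eq_of_heq e))

/-- A stretcher with a path on at least four vertices is not unipolar: the core would have to meet
the triples of consecutive vertices around both ends of that path. -/
theorem not_isUnipolarCore_oddStretcher (hl : ∀ i, 1 ≤ l i) {a : Fin 3} (ha : 2 ≤ l a)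
    (C : Set (Σ i : Fin 3, Fin (2 * l i))) : ¬ IsUnipolarCore (oddStretcher l) C := by
  intro h
  obtain ⟨b, c, hab, hac, hbc⟩ : ∃ b c : Fin 3, a ≠ b ∧ a ≠ c ∧ b ≠ c :=
    (by decide : ∀ a : Fin 3, ∃ b c : Fin 3, a ≠ b ∧ a ≠ c ∧ b ≠ c) a
  have hlb := hl b
  have hlc := hl c
  have path : ∀ x y z, (oddStretcher l).Adj x y → (oddStretcher l).Adj y z → x ≠ z →
      ¬ (oddStretcher l).Adj x z → x ∈ C ∨ y ∈ C ∨ z ∈ C := by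
    intro x y z hxy hyz hne hn
    by_contra! hcon
    exact hn (h.adj_of_adj x y z hcon.1 hcon.2.1 hcon.2.2 hxy hyz hne)
  have clique : ∀ {i j : Fin 3} {k k' : ℕ} (hk : k < 2 * l i) (hk' : k' < 2 * l j),
      (⟨i, k, hk⟩ : Σ i : Fin 3, Fin (2 * l i)) ∈ C → ⟨j, k', hk'⟩ ∈ C → (i ≠ j ∨ k ≠ k') →
      (i = j ∧ (k + 1 = k' ∨ k' + 1 = k)) ∨
        (i ≠ j ∧ ((k = 0 ∧ k' = 0) ∨ (k + 1 = 2 * l i ∧ k' + 1 = 2 * l j))) :=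
    fun hk hk' hx hy hne =>
      (oddStretcher_adj_iff hk hk').1 (h.isClique hx hy (mk_ne_mk_of_ne hk hk' hne))
  have start : ∀ j, a ≠ j → ∀ hj : 0 < 2 * l j, (⟨j, 0, hj⟩ : Σ i : Fin 3, Fin (2 * l i)) ∈ C ∨
      ⟨a, 0, by omega⟩ ∈ C ∨ ⟨a, 1, by omega⟩ ∈ C := by
    intro j haj hj
    refine path _ _ _ ((oddStretcher_adj_iff _ _).2 ?_) ((oddStretcher_adj_iff _ _).2 ?_)
      (mk_ne_mk_of_ne _ _ ?_) ((oddStretcher_adj_iff _ _).not.2 ?_)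
    · exact Or.inr ⟨haj.symm, Or.inl ⟨rfl, rfl⟩⟩
    · exact Or.inl ⟨rfl, Or.inl rfl⟩
    · exact Or.inl haj.symm
    · omega
  have finish : ∀ j, a ≠ j → ∀ hj : 2 * l j - 1 < 2 * l j,
      (⟨j, 2 * l j - 1, hj⟩ : Σ i : Fin 3, Fin (2 * l i)) ∈ C ∨
      ⟨a, 2 * l a - 1, by omega⟩ ∈ C ∨ ⟨a, 2 * l a - 2, by omega⟩ ∈ C := by
    intro j haj hj
    refine path _ _ _ ((oddStretcher_adj_iff _ _).2 ?_) ((oddStretcher_adj_iff _ _).2 ?_)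
      (mk_ne_mk_of_ne _ _ ?_) ((oddStretcher_adj_iff _ _).not.2 ?_)
    · exact Or.inr ⟨haj.symm, Or.inr ⟨by omega, by omega⟩⟩
    · exact Or.inl ⟨rfl, Or.inr (by omega)⟩
    · exact Or.inl haj.symm
    · omega
  by_cases hP : (⟨a, 0, by omega⟩ : Σ i : Fin 3, Fin (2 * l i)) ∈ C ∨ ⟨a, 1, by omega⟩ ∈ C
  · by_cases hQ : (⟨a, 2 * l a - 1, by omega⟩ : Σ i : Fin 3, Fin (2 * l i)) ∈ C ∨
        ⟨a, 2 * l a - 2, by omega⟩ ∈ C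
    · -- Both ends of the path meet the core, so the core consists of the two inner vertices of a
      -- path on four vertices.
      have hin : (⟨a, 1, by omega⟩ : Σ i : Fin 3, Fin (2 * l i)) ∈ C ∧
          (⟨a, 2 * l a - 2, by omega⟩ : Σ i : Fin 3, Fin (2 * l i)) ∈ C ∧ l a = 2 := by
        rcases hP with hP | hP <;> rcases hQ with hQ | hQ <;>
          have := clique _ _ hP hQ (Or.inr (by omega))
        · omega
        · omega
        · omega
        · exact ⟨hP, hQ, by omega⟩
      obtain ⟨h1, h2, hla⟩ := hin
      rcases path ⟨a, 0, by omega⟩ ⟨b, 0, by omega⟩ ⟨b, 1, by omega⟩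
        ((oddStretcher_adj_iff _ _).2 (Or.inr ⟨hab, Or.inl ⟨rfl, rfl⟩⟩))
        ((oddStretcher_adj_iff _ _).2 (Or.inl ⟨rfl, Or.inl rfl⟩))
        (mk_ne_mk_of_ne _ _ (Or.inl hab)) ((oddStretcher_adj_iff _ _).not.2 (by omega))
        with h3 | h3 | h3
      · have := clique _ _ h3 h2 (Or.inr (by omega))
        omega
      · have := clique _ _ h3 h1 (Or.inl hab.symm)
        omega
      · have := clique _ _ h3 h1 (Or.inl hab.symm)
        omega
    · have h1 := (finish b hab (by omega)).resolve_right hQ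
      have h2 := (finish c hac (by omega)).resolve_right hQ
      rcases hP with hP | hP <;>
      · have := clique _ _ hP h1 (Or.inl hab)
        omega
  · have h1 := (start b hab (by omega)).resolve_right hP
    rcases finish c hac (by omega) with h2 | h2 | h2
    · have := clique _ _ h1 h2 (Or.inl hbc)
      omega
    · have := clique _ _ h1 h2 (Or.inl hab.symm)
      omega
    · have := clique _ _ h1 h2 (Or.inl hab.symm)
      omega

/-- The complement of a stretcher is not unipolar: two vertices of the first triangle lie outside
the core, which forces the third path to contain two adjacent vertices of the core. -/
theorem not_isUnipolarCore_compl_oddStretcher (hl : ∀ i, 1 ≤ l i)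
    (C : Set (Σ i : Fin 3, Fin (2 * l i))) : ¬ IsUnipolarCore (oddStretcher l)ᶜ C := by
  intro h
  have stable : ∀ {x y}, (oddStretcher l).Adj x y → x ∈ C → y ∉ C := fun hxy hx hy =>
    ((SimpleGraph.compl_adj _ _ _).1 (h.isClique hx hy hxy.ne)).2 hxy
  have dominate : ∀ {x y z}, (oddStretcher l).Adj x y → x ∉ C → y ∉ C → x ≠ z → y ≠ z →
      ¬ (oddStretcher l).Adj x z → ¬ (oddStretcher l).Adj y z → z ∈ C := by
    intro x y z hxy hx hy hxz hyz hnx hny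
    by_contra hz
    exact ((SimpleGraph.compl_adj _ _ _).1 (h.adj_of_adj x z y hx hz hy
      ((SimpleGraph.compl_adj _ _ _).2 ⟨hxz, hnx⟩)
      ((SimpleGraph.compl_adj _ _ _).2 ⟨hyz, hny⟩).symm hxy.ne)).2 hxy
  have hpos : ∀ i, 0 < 2 * l i := fun i => by have := hl i; omega
  have hfirst : ∀ i j, i ≠ j → (oddStretcher l).Adj ⟨i, 0, hpos i⟩ ⟨j, 0, hpos j⟩ := fun i j hij =>
    (oddStretcher_adj_iff _ _).2 (Or.inr ⟨hij, Or.inl ⟨rfl, rfl⟩⟩)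
  obtain ⟨a, b, c, hab, hac, hbc, ha, hb⟩ : ∃ a b c : Fin 3, a ≠ b ∧ a ≠ c ∧ b ≠ c ∧
      (⟨a, 0, hpos a⟩ : Σ i : Fin 3, Fin (2 * l i)) ∉ C ∧
      (⟨b, 0, hpos b⟩ : Σ i : Fin 3, Fin (2 * l i)) ∉ C := by
    by_cases h0 : (⟨0, 0, hpos 0⟩ : Σ i : Fin 3, Fin (2 * l i)) ∈ C
    · exact ⟨1, 2, 0, by decide, by decide, by decide, stable (hfirst 0 1 (by decide)) h0,
        stable (hfirst 0 2 (by decide)) h0⟩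
    · by_cases h1 : (⟨1, 0, hpos 1⟩ : Σ i : Fin 3, Fin (2 * l i)) ∈ C
      · exact ⟨0, 2, 1, by decide, by decide, by decide, h0, stable (hfirst 1 2 (by decide)) h1⟩
      · exact ⟨0, 1, 2, by decide, by decide, by decide, h0, h1⟩
  have hla := hl a
  have hlb := hl b
  have hlc := hl c
  have hlast : (⟨c, 2 * l c - 1, by omega⟩ : Σ i : Fin 3, Fin (2 * l i)) ∈ C :=
    dominate (hfirst a b hab) ha hb (mk_ne_mk_of_ne _ _ (Or.inl hac))
      (mk_ne_mk_of_ne _ _ (Or.inl hbc)) ((oddStretcher_adj_iff _ _).not.2 (by omega))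
      ((oddStretcher_adj_iff _ _).not.2 (by omega))
  have hone : (⟨c, 1, by omega⟩ : Σ i : Fin 3, Fin (2 * l i)) ∈ C :=
    dominate (hfirst a b hab) ha hb (mk_ne_mk_of_ne _ _ (Or.inl hac))
      (mk_ne_mk_of_ne _ _ (Or.inl hbc)) ((oddStretcher_adj_iff _ _).not.2 (by omega))
      ((oddStretcher_adj_iff _ _).not.2 (by omega))
  have hla' : (⟨a, 2 * l a - 1, by omega⟩ : Σ i : Fin 3, Fin (2 * l i)) ∉ C :=
    stable ((oddStretcher_adj_iff _ _).2 (Or.inr ⟨hac.symm, Or.inr ⟨by omega, by omega⟩⟩)) hlast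
  have hlb' : (⟨b, 2 * l b - 1, by omega⟩ : Σ i : Fin 3, Fin (2 * l i)) ∉ C :=
    stable ((oddStretcher_adj_iff _ _).2 (Or.inr ⟨hbc.symm, Or.inr ⟨by omega, by omega⟩⟩)) hlast
  have hzero : (⟨c, 0, by omega⟩ : Σ i : Fin 3, Fin (2 * l i)) ∈ C :=
    dominate ((oddStretcher_adj_iff _ _).2 (Or.inr ⟨hab, Or.inr ⟨by omega, by omega⟩⟩)) hla' hlb'
      (mk_ne_mk_of_ne _ _ (Or.inl hac))
      (mk_ne_mk_of_ne _ _ (Or.inl hbc)) ((oddStretcher_adj_iff _ _).not.2 (by omega))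
      ((oddStretcher_adj_iff _ _).not.2 (by omega))
  exact stable ((oddStretcher_adj_iff _ _).2 (Or.inl ⟨rfl, Or.inl rfl⟩)) hzero hone

/-- The smallest stretcher, the triangular prism, is the antihole of length six. -/
theorem compl_cycleGraph_six_isIndContained :
    (SimpleGraph.cycleGraph 6)ᶜ ⊴ oddStretcher fun _ => 1 := by
  refine ⟨⟨⟨fun k : Fin 6 => ⟨⟨k % 3, Nat.mod_lt _ (by norm_num)⟩,
    ⟨k % 2, Nat.mod_lt _ (by norm_num)⟩⟩, ?_⟩, ?_⟩⟩
  · intro k k' e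
    have h1 := congrArg Fin.val (Sigma.mk.inj_iff.1 e).1
    have h2 := congrArg Fin.val (eq_of_heq (Sigma.mk.inj_iff.1 e).2)
    simp only at h1 h2
    have := k.2
    have := k'.2
    exact Fin.ext (by omega)
  · intro k k'
    have := k.2
    have := k'.2
    refine (oddStretcher_adj_iff _ _).trans ?_
    simp only [SimpleGraph.compl_adj, cycleGraph_adj_iff_val (show 3 ≤ 6 by norm_num), ne_eq,
      Fin.ext_iff]
    generalize (k : ℕ) = x at *
    generalize (k' : ℕ) = y at *
    interval_cases x <;> interval_cases y <;> simp

theorem IsGeneralizedSplit.noOddStretchers {V : Type u} {G : SimpleGraph V}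
    (hG : IsGeneralizedSplit G) (hA : NoAntiholes G) : NoOddStretchers G := by
  rintro l hl ⟨f⟩
  rcases hG with h | h
  · obtain ⟨C, hC⟩ := h.exists_isUnipolarCore
    by_cases hbig : ∃ a, 2 ≤ l a
    · obtain ⟨a, ha⟩ := hbig
      exact not_isUnipolarCore_oddStretcher hl ha _ (hC.comap f)
    · have hone : l = fun _ => 1 := by
        funext i
        have := hl i
        have : ¬ 2 ≤ l i := fun h => hbig ⟨i, h⟩
        omega
      subst hone
      exact hA 6 (by norm_num) (compl_cycleGraph_six_isIndContained.trans ⟨f⟩)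
  · obtain ⟨C, hC⟩ := h.exists_isUnipolarCore
    exact not_isUnipolarCore_compl_oddStretcher hl _
      (hC.comap (SimpleGraph.Embedding.complEquiv f))

end Stretcher

end StableSetToric
end

theorem proposition3p5 {V : Type u} [Finite V] (G : SimpleGraph V)
    (hG : StableSetToric.IsGeneralizedSplit G) :
    (StableSetToric.NoAntiholes G →
      (∀ c : G.ConnectedComponent,
        StableSetToric.IsCliqueGluing G (StableSetToric.componentSubgraph c)) ∧
      ∀ (K : Type v) [Field K], ∃ m : MonomialOrder.{u, u} (StableSetToric.StableSet G),
        StableSetToric.GeneratedBySquarefreeQuadraticMonomials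
          (StableSetToric.initialIdeal m (StableSetToric.toricIdeal G K))) ∧
    ∀ (K : Type v) [Field K],
      StableSetToric.GeneratedByQuadraticBinomials (StableSetToric.toricIdeal G K) ↔
        StableSetToric.NoOddHoles G ∧ StableSetToric.NoAntiholes G ∧
          StableSetToric.NoOddStretchers G := by
  refine ⟨fun hA => ⟨hG.isCliqueGluing_componentSubgraph hA, fun K _ => ?_⟩,
    fun K _ => ⟨fun hgen => ?_, fun ⟨_, hA, _⟩ => ?_⟩⟩
  · obtain ⟨w, hw⟩ := hG.exists_isQuadraticWeight hA Set.univ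
    exact hw.isGroebnerWeight.exists_initialIdeal (StableSetToric.toricMap_monomial K)
  · have hA := hG.noAntiholes hgen
    exact ⟨hG.noOddHoles, hA, hG.noOddStretchers hA⟩
  · obtain ⟨w, hw⟩ := hG.exists_isQuadraticWeight hA Set.univ
    exact hw.isGroebnerWeight.generatedByQuadraticBinomials (StableSetToric.toricMap_monomial K)
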